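/- **Theorem (homogenization of variational eigenvalues).** Let $N\ge 1$, $0<s<1\le p<\infty$, and let $\Omega\subset\mathbb R^N$ be an open set of finite measure. Let $$[u]_{s,p}=\Big(\iint_{\mathbb R^N\times\mathbb R^N}\frac{|u(x)-u(y)|^p}{|x-y|^{N+sp}}\,dx\,dy\Big)^{1/p},$$ and let $W^{s,p}_0(\Omega)$ be the space of all $u\in L^p(\mathbb R^N)$ with $[u]_{s,p}<\infty$ and $u=0$ a.e. in $\mathbb R^N\setminus\Omega$, with the norm $\|u\|_{s,p}=(\|u\|_p^p+[u]_{s,p}^p)^{1/p}$. For a symmetric set $G\subset W^{s,p}_0(\Omega)$ let the Krasnoselskii genus $\gamma(G)$ be the least $m$ for which there is a continuous odd map $G\to\mathbb R^m\setminus\{0\}$ ($\gamma(G)=\infty$ if there is none). For $k\ge 1$ let $\mathcal G^k_{s,p}$ be the class of all sets $G=-G\subset W^{s,p}_0(\Omega)$ that are closed and bounded in $W^{s,p}_0(\Omega)$, with $\|u\|_p=1$ for all $u\in G$ and $\gamma(G)\ge k$. Let $0<\alpha\le\beta<\infty$, and let $a_n$ $(n\ge 0)$ be functions in $L^\infty(\mathbb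 R^N\times\mathbb R^N)$ with $a_n(x,y)=a_n(y,x)$ and $\alpha\le a_n(x,y)\le\beta$ for a.e. $(x,y)$, such that $a_n\stackrel{*}{\rightharpoonup}a_0$ weakly* in $L^\infty(\mathbb R^N\times\mathbb R^N)$ as $n\to\infty$. For $n\ge 0$ and $k\ge1$ put $$\lambda_k^n=\inf_{G\in\mathcal G^k_{s,p}}\ \sup_{v\in G}\ \frac{1}{\|v\|_p}\Big(\iint_{\mathbb R^N\times\mathbb R^N}a_n(x,y)\frac{|v(x)-v(y)|^p}{|x-y|^{N+sp}}\,dx\,dy\Big)^{1/p},$$ an element of $[0,\infty]$ (with $\inf\emptyset=\infty$). Then, in $[0,\infty]$, $$\lim_{n\to\infty}\lambda_k^n=\lambda_k^0\qquad\text{for every integer } k\ge 1.$$ -/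

import Mathlib

open MeasureTheory Filter Topology
open scoped ENNReal

noncomputable section

namespace FracHomog

instance factOneLeOfReal {p : ℝ} [hp : Fact (1 ≤ p)] : Fact (1 ≤ ENNReal.ofReal p) :=
  ⟨by simpa using ENNReal.ofReal_le_ofReal hp.out⟩

/-- The Gagliardo seminorm
`[u]_{s,p} = (∬ |u x - u y| ^ p / |x - y| ^ (N + s p) dx dy) ^ (1 / p)`, with values in `[0, ∞]`. -/
def gagliardo {N : ℕ} (s p : ℝ) (u : EuclideanSpace ℝ (Fin N) → ℝ) : ℝ≥0∞ :=
  (∫⁻ z : EuclideanSpace ℝ (Fin N) × EuclideanSpace ℝ (Fin N),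
    ENNReal.ofReal (|u z.1 - u z.2| ^ p / ‖z.1 - z.2‖ ^ ((N : ℝ) + s * p))) ^ (1 / p)

/-- The weighted difference quotient whose `L^p` norm is the Gagliardo seminorm. -/
def diffQuot {N : ℕ} (s p : ℝ) (u : EuclideanSpace ℝ (Fin N) → ℝ)
    (z : EuclideanSpace ℝ (Fin N) × EuclideanSpace ℝ (Fin N)) : ℝ :=
  (u z.1 - u z.2) / ‖z.1 - z.2‖ ^ (((N : ℝ) + s * p) / p)

theorem gagliardo_eq_eLpNorm {N : ℕ} (s p : ℝ) (hp : 1 ≤ p)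
    (u : EuclideanSpace ℝ (Fin N) → ℝ) :
    gagliardo s p u = eLpNorm (diffQuot s p u) (ENNReal.ofReal p) volume := by
  have hp0 : 0 < p := by linarith
  rw [eLpNorm_eq_lintegral_rpow_enorm_toReal (by simpa using hp0) ENNReal.ofReal_ne_top,
    ENNReal.toReal_ofReal hp0.le, gagliardo]
  congr 1
  refine lintegral_congr fun z => ?_
  rw [diffQuot, ← ofReal_norm, ENNReal.ofReal_rpow_of_nonneg (norm_nonneg _) hp0.le,
    norm_div, Real.div_rpow (norm_nonneg _) (norm_nonneg _), Real.norm_eq_abs, Real.norm_eq_abs,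
    abs_of_nonneg (Real.rpow_nonneg (norm_nonneg _) _), ← Real.rpow_mul (norm_nonneg _),
    div_mul_cancel₀ _ hp0.ne']

theorem aestronglyMeasurable_diffQuot {N : ℕ} (s p : ℝ) {u : EuclideanSpace ℝ (Fin N) → ℝ}
    (hu : AEStronglyMeasurable u volume) :
    AEStronglyMeasurable (diffQuot s p u) volume := by
  have h1 : AEStronglyMeasurable
      (fun z : EuclideanSpace ℝ (Fin N) × EuclideanSpace ℝ (Fin N) => u z.1) volume :=
    hu.comp_quasiMeasurePreserving Measure.quasiMeasurePreserving_fst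
  have h2 : AEStronglyMeasurable
      (fun z : EuclideanSpace ℝ (Fin N) × EuclideanSpace ℝ (Fin N) => u z.2) volume :=
    hu.comp_quasiMeasurePreserving Measure.quasiMeasurePreserving_snd
  have h3 : Measurable fun z : EuclideanSpace ℝ (Fin N) × EuclideanSpace ℝ (Fin N) =>
      ‖z.1 - z.2‖ ^ (((N : ℝ) + s * p) / p) := by fun_prop
  exact (h1.sub h2).div₀ h3.aestronglyMeasurable

theorem diffQuot_congr {N : ℕ} (s p : ℝ) {u v : EuclideanSpace ℝ (Fin N) → ℝ}
    (h : u =ᵐ[volume] v) : diffQuot s p u =ᵐ[volume] diffQuot s p v := by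
  have h1 : ∀ᵐ z : EuclideanSpace ℝ (Fin N) × EuclideanSpace ℝ (Fin N), u z.1 = v z.1 :=
    Measure.quasiMeasurePreserving_fst.ae h
  have h2 : ∀ᵐ z : EuclideanSpace ℝ (Fin N) × EuclideanSpace ℝ (Fin N), u z.2 = v z.2 :=
    Measure.quasiMeasurePreserving_snd.ae h
  filter_upwards [h1, h2] with z hz1 hz2
  rw [diffQuot, diffQuot, hz1, hz2]

theorem gagliardo_congr {N : ℕ} (s p : ℝ) (hp : 1 ≤ p) {u v : EuclideanSpace ℝ (Fin N) → ℝ}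
    (h : u =ᵐ[volume] v) : gagliardo s p u = gagliardo s p v := by
  rw [gagliardo_eq_eLpNorm s p hp, gagliardo_eq_eLpNorm s p hp,
    eLpNorm_congr_ae (diffQuot_congr s p h)]

theorem gagliardo_add_le {N : ℕ} (s p : ℝ) (hp : 1 ≤ p) {u v : EuclideanSpace ℝ (Fin N) → ℝ}
    (hu : AEStronglyMeasurable u volume) (hv : AEStronglyMeasurable v volume) :
    gagliardo s p (u + v) ≤ gagliardo s p u + gagliardo s p v := by
  rw [gagliardo_eq_eLpNorm s p hp, gagliardo_eq_eLpNorm s p hp, gagliardo_eq_eLpNorm s p hp]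
  have h : diffQuot s p (u + v) = diffQuot s p u + diffQuot s p v := by
    funext z
    simp only [diffQuot, Pi.add_apply]
    ring
  rw [h]
  exact eLpNorm_add_le (aestronglyMeasurable_diffQuot s p hu)
    (aestronglyMeasurable_diffQuot s p hv) (by simpa using ENNReal.ofReal_le_ofReal hp)

theorem gagliardo_smul {N : ℕ} (s p : ℝ) (hp : 1 ≤ p) (c : ℝ)
    (u : EuclideanSpace ℝ (Fin N) → ℝ) :
    gagliardo s p (c • u) = ‖c‖ₑ * gagliardo s p u := by
  rw [gagliardo_eq_eLpNorm s p hp, gagliardo_eq_eLpNorm s p hp]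
  have h : diffQuot s p (c • u) = c • diffQuot s p u := by
    funext z
    simp only [diffQuot, Pi.smul_apply, smul_eq_mul]
    ring
  rw [h, eLpNorm_const_smul]

/-- The vector space of those `u ∈ L^p(ℝ^N)` with `[u]_{s,p} < ∞` and `u = 0` a.e. outside `Ω`. -/
def fracSobolevSubmodule (N : ℕ) (s p : ℝ) [hp : Fact (1 ≤ p)]
    (Ω : Set (EuclideanSpace ℝ (Fin N))) :
    Submodule ℝ (Lp ℝ (ENNReal.ofReal p) (volume : Measure (EuclideanSpace ℝ (Fin N)))) where
  carrier := {u | gagliardo s p u < ∞ ∧ ∀ᵐ x : EuclideanSpace ℝ (Fin N), x ∉ Ω → u x = 0}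
  zero_mem' := by
    have h0 := Lp.coeFn_zero ℝ (ENNReal.ofReal p)
      (volume : Measure (EuclideanSpace ℝ (Fin N)))
    refine ⟨?_, ?_⟩
    · have h1 := gagliardo_smul s p hp.out 0 (0 : EuclideanSpace ℝ (Fin N) → ℝ)
      rw [gagliardo_congr s p hp.out h0]
      simp at h1
      simp [h1]
    · filter_upwards [h0] with x hx _
      exact hx
  add_mem' := by
    rintro u v ⟨hu, hu'⟩ ⟨hv, hv'⟩
    refine ⟨?_, ?_⟩
    · rw [gagliardo_congr s p hp.out (Lp.coeFn_add u v)]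
      exact (gagliardo_add_le s p hp.out (Lp.aestronglyMeasurable u)
        (Lp.aestronglyMeasurable v)).trans_lt (ENNReal.add_lt_top.2 ⟨hu, hv⟩)
    · filter_upwards [Lp.coeFn_add u v, hu', hv'] with x hx h1 h2 hxΩ
      rw [hx, Pi.add_apply, h1 hxΩ, h2 hxΩ, add_zero]
  smul_mem' := by
    rintro c u ⟨hu, hu'⟩
    refine ⟨?_, ?_⟩
    · rw [gagliardo_congr s p hp.out (Lp.coeFn_smul c u), gagliardo_smul s p hp.out]
      exact ENNReal.mul_lt_top enorm_lt_top hu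
    · filter_upwards [Lp.coeFn_smul c u, hu'] with x hx h1 hxΩ
      simp [hx, h1 hxΩ]

/-- The fractional Sobolev space `W_0^{s,p}(Ω)`. It is a type of its own, so that it carries the
`W^{s,p}` norm below and not the `L^p` norm. -/
def W0 (N : ℕ) (s p : ℝ) [Fact (1 ≤ p)] (Ω : Set (EuclideanSpace ℝ (Fin N))) : Type :=
  ↥(fracSobolevSubmodule N s p Ω)

namespace W0

variable {N : ℕ} {s p : ℝ} [Fact (1 ≤ p)] {Ω : Set (EuclideanSpace ℝ (Fin N))}

instance : AddCommGroup (W0 N s p Ω) :=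
  inferInstanceAs (AddCommGroup ↥(fracSobolevSubmodule N s p Ω))

instance : Module ℝ (W0 N s p Ω) :=
  inferInstanceAs (Module ℝ ↥(fracSobolevSubmodule N s p Ω))

/-- The inclusion `W_0^{s,p}(Ω) ⊆ L^p(ℝ^N)`. -/
def toLp : W0 N s p Ω →ₗ[ℝ]
    Lp ℝ (ENNReal.ofReal p) (volume : Measure (EuclideanSpace ℝ (Fin N))) :=
  (fracSobolevSubmodule N s p Ω).subtype

theorem toLp_injective : Function.Injective (toLp (N := N) (s := s) (p := p) (Ω := Ω)) :=
  Subtype.val_injective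

/-- The Gagliardo seminorm of an element of `W_0^{s,p}(Ω)`, a real number. -/
def semi (u : W0 N s p Ω) : ℝ := (gagliardo s p (toLp u)).toReal

theorem gagliardo_ne_top (u : W0 N s p Ω) : gagliardo s p (toLp u) ≠ ∞ :=
  (Subtype.property u).1.ne

theorem semi_nonneg (u : W0 N s p Ω) : 0 ≤ semi u := ENNReal.toReal_nonneg

theorem semi_add_le (u v : W0 N s p Ω) : semi (u + v) ≤ semi u + semi v := by
  have hp : 1 ≤ p := Fact.out
  rw [semi, semi, semi, ← ENNReal.toReal_add (gagliardo_ne_top u) (gagliardo_ne_top v)]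
  refine ENNReal.toReal_mono (ENNReal.add_ne_top.2 ⟨gagliardo_ne_top u, gagliardo_ne_top v⟩) ?_
  rw [map_add, gagliardo_congr s p hp (Lp.coeFn_add _ _)]
  exact gagliardo_add_le s p hp (Lp.aestronglyMeasurable _) (Lp.aestronglyMeasurable _)

theorem semi_smul (c : ℝ) (u : W0 N s p Ω) : semi (c • u) = |c| * semi u := by
  have hp : 1 ≤ p := Fact.out
  rw [semi, semi, map_smul, gagliardo_congr s p hp (Lp.coeFn_smul _ _), gagliardo_smul s p hp,
    ENNReal.toReal_mul, toReal_enorm, Real.norm_eq_abs]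

/-- The norm `‖u‖_{s,p} = (‖u‖_p ^ p + [u]_{s,p} ^ p) ^ (1 / p)`. -/
instance : Norm (W0 N s p Ω) := ⟨fun u => (‖toLp u‖ ^ p + semi u ^ p) ^ (1 / p)⟩

theorem norm_def (u : W0 N s p Ω) : ‖u‖ = (‖toLp u‖ ^ p + semi u ^ p) ^ (1 / p) := rfl

theorem norm_smul_eq (c : ℝ) (u : W0 N s p Ω) : ‖c • u‖ = |c| * ‖u‖ := by
  have hp : 1 ≤ p := Fact.out
  have hp0 : 0 < p := by linarith
  rw [norm_def, norm_def, map_smul, norm_smul, Real.norm_eq_abs, semi_smul,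
    Real.mul_rpow (abs_nonneg _) (norm_nonneg _), Real.mul_rpow (abs_nonneg _) (semi_nonneg _),
    ← mul_add, Real.mul_rpow (by positivity)
      (add_nonneg (by positivity) (Real.rpow_nonneg (semi_nonneg _) _)),
    ← Real.rpow_mul (abs_nonneg _), mul_one_div_cancel hp0.ne', Real.rpow_one]

theorem norm_add_le' (u v : W0 N s p Ω) : ‖u + v‖ ≤ ‖u‖ + ‖v‖ := by
  have hp : 1 ≤ p := Fact.out
  have hp0 : 0 < p := by linarith
  have key := Real.Lp_add_le_of_nonneg (s := (Finset.univ : Finset (Fin 2)))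
    (f := ![‖toLp u‖, semi u]) (g := ![‖toLp v‖, semi v]) hp
    (by intro i _; fin_cases i <;> simp [semi_nonneg])
    (by intro i _; fin_cases i <;> simp [semi_nonneg])
  simp only [Fin.sum_univ_two, Matrix.cons_val_zero, Matrix.cons_val_one] at key
  rw [norm_def, norm_def, norm_def]
  refine le_trans ?_ key
  have h1 : ‖toLp (u + v)‖ ≤ ‖toLp u‖ + ‖toLp v‖ := by
    rw [map_add]; exact norm_add_le _ _
  have h2 := semi_add_le u v
  have h3 := semi_nonneg (u + v)
  gcongr

instance : NormedAddCommGroup (W0 N s p Ω) :=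
  AddGroupNorm.toNormedAddCommGroup
    { toFun := fun u => ‖u‖
      map_zero' := by
        have h := norm_smul_eq (0 : ℝ) (0 : W0 N s p Ω)
        simpa using h
      add_le' := norm_add_le'
      neg' := fun u => by
        have h := norm_smul_eq (-1 : ℝ) u
        simpa using h
      eq_zero_of_map_eq_zero' := fun u hu => by
        have hp : 1 ≤ p := Fact.out
        have hp0 : 0 < p := by linarith
        have h1 : 0 ≤ ‖toLp u‖ ^ p := Real.rpow_nonneg (norm_nonneg _) _
        have h2 : 0 ≤ semi u ^ p := Real.rpow_nonneg (semi_nonneg _) _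
        have hu' : (‖toLp u‖ ^ p + semi u ^ p) ^ (1 / p) = 0 := hu
        rw [Real.rpow_eq_zero (add_nonneg h1 h2) (by positivity)] at hu'
        have h3 : ‖toLp u‖ ^ p = 0 := by linarith
        rw [Real.rpow_eq_zero (norm_nonneg _) hp0.ne', norm_eq_zero] at h3
        exact toLp_injective (by rw [h3, map_zero]) }

instance : NormedSpace ℝ (W0 N s p Ω) where
  norm_smul_le c u := by
    rw [Real.norm_eq_abs]
    exact (norm_smul_eq c u).le

end W0

/-- The Krasnoselskii genus of a symmetric set `A`: the least `m` for which there is a continuous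
odd map `A → ℝ^m ∖ {0}`, and `∞` if there is none. -/
def genus {X : Type*} [NormedAddCommGroup X] (A : Set X) : ℕ∞ :=
  ⨅ (m : ℕ) (_ : ∃ φ : X → EuclideanSpace ℝ (Fin m),
    ContinuousOn φ A ∧ (∀ x ∈ A, φ (-x) = -φ x) ∧ ∀ x ∈ A, φ x ≠ 0), (m : ℕ∞)

/-- The class `𝒢^k_{s,p}` of the closed, bounded, symmetric subsets of `W_0^{s,p}(Ω)` of genus at
least `k` whose elements have `L^p` norm one. -/
def genusClass (N : ℕ) (s p : ℝ) [Fact (1 ≤ p)] (Ω : Set (EuclideanSpace ℝ (Fin N))) (k : ℕ) :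
    Set (Set (W0 N s p Ω)) :=
  {G | (∀ u ∈ G, -u ∈ G) ∧ IsClosed G ∧ Bornology.IsBounded G ∧
    (∀ u ∈ G, ‖W0.toLp u‖ = 1) ∧ (k : ℕ∞) ≤ genus G}

/-- The class `𝒜_{α,β}` of the symmetric kernels in `L^∞` with values in `[α, β]`. -/
def kernelClass (N : ℕ) (α β : ℝ) :
    Set (EuclideanSpace ℝ (Fin N) × EuclideanSpace ℝ (Fin N) → ℝ) :=
  {a | MemLp a ∞ volume ∧ ∀ᵐ z, a z = a z.swap ∧ α ≤ a z ∧ a z ≤ β}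

/-- Weak* convergence in `L^∞`, the dual of `L^1`. -/
def WeakStarTendsto {N : ℕ}
    (a : ℕ → EuclideanSpace ℝ (Fin N) × EuclideanSpace ℝ (Fin N) → ℝ)
    (a₀ : EuclideanSpace ℝ (Fin N) × EuclideanSpace ℝ (Fin N) → ℝ) : Prop :=
  ∀ g : EuclideanSpace ℝ (Fin N) × EuclideanSpace ℝ (Fin N) → ℝ, Integrable g volume →
    Tendsto (fun n => ∫ z, a n z * g z) atTop (𝓝 (∫ z, a₀ z * g z))

/-- `Φ_a(u) = ∬ a(x,y) |u x - u y| ^ p / |x - y| ^ (N + s p) dx dy`. -/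
def energy {N : ℕ} (s p : ℝ) (a : EuclideanSpace ℝ (Fin N) × EuclideanSpace ℝ (Fin N) → ℝ)
    (u : EuclideanSpace ℝ (Fin N) → ℝ) : ℝ≥0∞ :=
  ∫⁻ z : EuclideanSpace ℝ (Fin N) × EuclideanSpace ℝ (Fin N),
    ENNReal.ofReal (a z * (|u z.1 - u z.2| ^ p / ‖z.1 - z.2‖ ^ ((N : ℝ) + s * p)))

/-- The `k`-th variational eigenvalue
`inf_{G ∈ 𝒢^k_{s,p}} sup_{v ∈ G} Φ_a(v) ^ (1 / p) / ‖v‖_p`, with values in `[0, ∞]`. -/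
def eigenvalue {N : ℕ} (s p : ℝ) [Fact (1 ≤ p)] (Ω : Set (EuclideanSpace ℝ (Fin N)))
    (a : EuclideanSpace ℝ (Fin N) × EuclideanSpace ℝ (Fin N) → ℝ) (k : ℕ) : ℝ≥0∞ :=
  ⨅ G ∈ genusClass N s p Ω k, ⨆ v ∈ G,
    energy s p a (W0.toLp v) ^ (1 / p) / ENNReal.ofReal ‖W0.toLp v‖

end FracHomog

end

namespace FracHomog

/-! The `p`-th root of the energy is a seminorm comparable to the Gagliardo seminorm, and the
admissible sets do not depend on the kernel. Weak* convergence only gives convergence of the energy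
at each fixed function, so the sup over an infinite set `G` must be replaced by a max over finitely
many functions.

This is `eigenvalue_le_of_net`. If `G` lies within `L^p` distance `r < 1` of finitely many functions
of rooted energy at most `M`, a partition of unity made odd maps `G` continuously into the symmetric
convex hull of these functions. There the rooted energy stays at most `M` by convexity, and on the
image of `G` the `L^p` norm is at least `1 - r`. Normalizing costs a factor `1 / (1 - r)`, and an
odd continuous map does not lower the genus.

Upper bound: a nearly optimal `G` for the limit kernel has a finite `L^p`-net inside itself
(`exists_finite_net`), and the energies converge at the net points (`tendsto_rootEnergy`). Lower
bound: by compactness and the liminf inequality `energy_le_of_tendsto_ae`, the sublevels for `a n`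
eventually lie `L^p`-close to the sublevel for `a₀` (`eventually_sublevel_near`), which has a finite
net. Both bounds let `r` be small. -/

/-! ### Energies as weighted `L^p` norms. -/

theorem kernelClass.nonneg {N : ℕ} {α β : ℝ} (hα : 0 < α)
    {a : EuclideanSpace ℝ (Fin N) × EuclideanSpace ℝ (Fin N) → ℝ} (ha : a ∈ kernelClass N α β) :
    ∀ᵐ z, 0 ≤ a z :=
  ha.2.mono fun _ hz => hα.le.trans hz.2.1

/-- Absorbing `a ^ (1 / p)` into the integrand makes Minkowski's inequality available for the rooted
energy. -/
theorem energy_rpow_eq_eLpNorm {N : ℕ} (s p : ℝ) (hp : 1 ≤ p)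
    {a : EuclideanSpace ℝ (Fin N) × EuclideanSpace ℝ (Fin N) → ℝ} (ha : ∀ᵐ z, 0 ≤ a z)
    (u : EuclideanSpace ℝ (Fin N) → ℝ) :
    energy s p a u ^ (1 / p) =
      eLpNorm (fun z => a z ^ (1 / p) * diffQuot s p u z) (ENNReal.ofReal p) volume := by
  have hp0 : 0 < p := by linarith
  rw [eLpNorm_eq_lintegral_rpow_enorm_toReal (by simpa using hp0) ENNReal.ofReal_ne_top,
    ENNReal.toReal_ofReal hp0.le, energy]
  congr 1
  refine lintegral_congr_ae (ha.mono fun z hz => ?_)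
  dsimp only
  rw [diffQuot, ← ofReal_norm, ENNReal.ofReal_rpow_of_nonneg (norm_nonneg _) hp0.le, norm_mul,
    norm_div, Real.mul_rpow (norm_nonneg _) (by positivity),
    Real.div_rpow (norm_nonneg _) (norm_nonneg _), Real.norm_eq_abs, Real.norm_eq_abs,
    Real.norm_eq_abs, abs_of_nonneg (Real.rpow_nonneg (norm_nonneg _) _),
    ← Real.rpow_mul (norm_nonneg _), div_mul_cancel₀ _ hp0.ne',
    abs_of_nonneg (Real.rpow_nonneg hz _), ← Real.rpow_mul hz, one_div_mul_cancel hp0.ne',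
    Real.rpow_one]

theorem ofReal_mul_gagliardo_le {N : ℕ} (s p : ℝ) (hp : 1 ≤ p) {α β : ℝ} (hα : 0 < α)
    {a : EuclideanSpace ℝ (Fin N) × EuclideanSpace ℝ (Fin N) → ℝ} (ha : a ∈ kernelClass N α β)
    (u : EuclideanSpace ℝ (Fin N) → ℝ) :
    ENNReal.ofReal α ^ (1 / p) * gagliardo s p u ≤ energy s p a u ^ (1 / p) := by
  have hp0 : 0 ≤ 1 / p := by positivity
  rw [gagliardo, ← ENNReal.mul_rpow_of_nonneg _ _ hp0,
    ← lintegral_const_mul' _ _ ENNReal.ofReal_ne_top]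
  refine ENNReal.rpow_le_rpow (lintegral_mono_ae (ha.2.mono fun z hz => ?_)) hp0
  rw [← ENNReal.ofReal_mul hα.le]
  exact ENNReal.ofReal_le_ofReal (mul_le_mul_of_nonneg_right hz.2.1 (by positivity))

theorem energy_congr {N : ℕ} (s p : ℝ)
    (a : EuclideanSpace ℝ (Fin N) × EuclideanSpace ℝ (Fin N) → ℝ)
    {u v : EuclideanSpace ℝ (Fin N) → ℝ} (h : u =ᵐ[volume] v) :
    energy s p a u = energy s p a v := by
  have h1 : ∀ᵐ z : EuclideanSpace ℝ (Fin N) × EuclideanSpace ℝ (Fin N), u z.1 = v z.1 :=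
    Measure.quasiMeasurePreserving_fst.ae h
  have h2 : ∀ᵐ z : EuclideanSpace ℝ (Fin N) × EuclideanSpace ℝ (Fin N), u z.2 = v z.2 :=
    Measure.quasiMeasurePreserving_snd.ae h
  refine lintegral_congr_ae ?_
  filter_upwards [h1, h2] with z hz1 hz2
  rw [hz1, hz2]

/-- This makes the density of a fixed function a legitimate test function for weak* convergence. -/
theorem integrable_of_gagliardo_ne_top {N : ℕ} (s p : ℝ) (hp : 1 ≤ p)
    {u : EuclideanSpace ℝ (Fin N) → ℝ} (hu : AEStronglyMeasurable u volume)
    (h : gagliardo s p u ≠ ∞) :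
    Integrable (fun z : EuclideanSpace ℝ (Fin N) × EuclideanSpace ℝ (Fin N) =>
      |u z.1 - u z.2| ^ p / ‖z.1 - z.2‖ ^ ((N : ℝ) + s * p)) volume := by
  have hp0 : 0 < p := by linarith
  have hm : MemLp (diffQuot s p u) (ENNReal.ofReal p) volume :=
    ⟨aestronglyMeasurable_diffQuot s p hu, by
      rw [← gagliardo_eq_eLpNorm s p hp]; exact lt_top_iff_ne_top.2 h⟩
  have := hm.integrable_norm_rpow (by simpa using hp0) ENNReal.ofReal_ne_top
  refine this.congr (ae_of_all _ fun z => ?_)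
  dsimp only
  rw [ENNReal.toReal_ofReal hp0.le, diffQuot, norm_div,
    Real.div_rpow (norm_nonneg _) (norm_nonneg _), Real.norm_eq_abs, Real.norm_eq_abs,
    abs_of_nonneg (Real.rpow_nonneg (norm_nonneg _) _), ← Real.rpow_mul (norm_nonneg _),
    div_mul_cancel₀ _ hp0.ne']

namespace W0

variable {N : ℕ} {s p : ℝ} [Fact (1 ≤ p)] {Ω : Set (EuclideanSpace ℝ (Fin N))}

/-- The `p`-th root of the energy of an element of `W_0^{s,p}(Ω)`. -/
noncomputable def rootEnergy (a : EuclideanSpace ℝ (Fin N) × EuclideanSpace ℝ (Fin N) → ℝ)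
    (u : W0 N s p Ω) : ℝ≥0∞ :=
  energy s p a (toLp u) ^ (1 / p)

theorem ofReal_semi (u : W0 N s p Ω) : ENNReal.ofReal (semi u) = gagliardo s p (toLp u) :=
  ENNReal.ofReal_toReal (gagliardo_ne_top u)

section

variable {α β : ℝ} {a : EuclideanSpace ℝ (Fin N) × EuclideanSpace ℝ (Fin N) → ℝ}

theorem rootEnergy_add_le (hα : 0 < α) (ha : a ∈ kernelClass N α β) (u v : W0 N s p Ω) :
    rootEnergy a (u + v) ≤ rootEnergy a u + rootEnergy a v := by
  have hp : 1 ≤ p := Fact.out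
  have ha0 := kernelClass.nonneg hα ha
  have hm : AEStronglyMeasurable (fun z => a z ^ (1 / p)) volume :=
    (ha.1.1.aemeasurable.pow_const _).aestronglyMeasurable
  rw [rootEnergy, rootEnergy, rootEnergy, map_add, energy_congr s p a (Lp.coeFn_add _ _),
    energy_rpow_eq_eLpNorm s p hp ha0, energy_rpow_eq_eLpNorm s p hp ha0,
    energy_rpow_eq_eLpNorm s p hp ha0]
  refine le_trans (le_of_eq ?_) (eLpNorm_add_le
    (hm.mul (aestronglyMeasurable_diffQuot s p (Lp.aestronglyMeasurable (toLp u))))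
    (hm.mul (aestronglyMeasurable_diffQuot s p (Lp.aestronglyMeasurable (toLp v)))) Fact.out)
  congr 1
  funext z
  simp only [diffQuot, Pi.add_apply]
  ring

theorem rootEnergy_smul (hα : 0 < α) (ha : a ∈ kernelClass N α β) (c : ℝ) (u : W0 N s p Ω) :
    rootEnergy a (c • u) = ‖c‖ₑ * rootEnergy a u := by
  have hp : 1 ≤ p := Fact.out
  have ha0 := kernelClass.nonneg hα ha
  rw [rootEnergy, rootEnergy, map_smul, energy_congr s p a (Lp.coeFn_smul _ _),
    energy_rpow_eq_eLpNorm s p hp ha0, energy_rpow_eq_eLpNorm s p hp ha0, ← eLpNorm_const_smul]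
  congr 1
  funext z
  simp only [diffQuot, Pi.smul_apply, smul_eq_mul]
  ring

theorem rootEnergy_sum_le (hα : 0 < α) (ha : a ∈ kernelClass N α β) {ι : Type*} (F : Finset ι)
    (f : ι → W0 N s p Ω) : rootEnergy a (∑ i ∈ F, f i) ≤ ∑ i ∈ F, rootEnergy a (f i) := by
  refine Finset.le_sum_of_subadditive (rootEnergy a) ?_ (rootEnergy_add_le hα ha) F f
  simpa using rootEnergy_smul hα ha 0 (0 : W0 N s p Ω)

theorem semi_le_of_rootEnergy_le (hα : 0 < α) (ha : a ∈ kernelClass N α β) {M : ℝ≥0∞}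
    (hM : M ≠ ∞) {u : W0 N s p Ω} (hu : rootEnergy a u ≤ M) :
    semi u ≤ (M / ENNReal.ofReal α ^ (1 / p)).toReal := by
  have hp : 1 ≤ p := Fact.out
  have h0 : ENNReal.ofReal α ^ (1 / p) ≠ 0 := by
    simp only [ne_eq, ENNReal.rpow_eq_zero_iff, ENNReal.ofReal_eq_zero, not_or, not_and, not_lt]
    exact ⟨fun h => absurd h (not_le.2 hα), fun h => absurd h ENNReal.ofReal_ne_top⟩
  have ht : ENNReal.ofReal α ^ (1 / p) ≠ ∞ :=
    ENNReal.rpow_ne_top_of_nonneg (by positivity) ENNReal.ofReal_ne_top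
  refine ENNReal.toReal_mono (ENNReal.div_ne_top hM h0) ?_
  rw [ENNReal.le_div_iff_mul_le (Or.inl h0) (Or.inl ht), mul_comm]
  exact (ofReal_mul_gagliardo_le s p hp hα ha _).trans hu

end

theorem norm_toLp_le (u : W0 N s p Ω) : ‖toLp u‖ ≤ ‖u‖ := by
  have hp : 1 ≤ p := Fact.out
  have hp0 : 0 < p := by linarith
  have := Real.rpow_nonneg (semi_nonneg u) p
  have := Real.rpow_nonneg (norm_nonneg (toLp u)) p
  calc ‖toLp u‖ = (‖toLp u‖ ^ p) ^ (1 / p) := by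
        rw [one_div, Real.rpow_rpow_inv (norm_nonneg _) hp0.ne']
    _ ≤ ‖u‖ := by
        rw [norm_def]
        gcongr
        linarith

theorem continuous_toLp : Continuous (toLp (N := N) (s := s) (p := p) (Ω := Ω)) :=
  AddMonoidHomClass.continuous_of_bound toLp 1 fun u => by simpa using norm_toLp_le u

end W0

/-! ### Genus and odd maps into the hull of a finite net. -/

/-- On sets of functions of `L^p` norm one, the quotient in `eigenvalue` is the rooted energy. -/
theorem eigenvalue_eq {N : ℕ} (s p : ℝ) [Fact (1 ≤ p)] (Ω : Set (EuclideanSpace ℝ (Fin N)))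
    (a : EuclideanSpace ℝ (Fin N) × EuclideanSpace ℝ (Fin N) → ℝ) (k : ℕ) :
    eigenvalue s p Ω a k = ⨅ G ∈ genusClass N s p Ω k, ⨆ v ∈ G, W0.rootEnergy a v := by
  refine iInf_congr fun G => iInf_congr fun hG => iSup_congr fun v => iSup_congr fun hv => ?_
  rw [hG.2.2.2.1 v hv, ENNReal.ofReal_one, div_one, W0.rootEnergy]

theorem genus_le_genus {X Y : Type*} [NormedAddCommGroup X] [NormedAddCommGroup Y] {A : Set X}
    {B : Set Y} (f : X → Y) (hf : ContinuousOn f A) (hodd : ∀ x ∈ A, f (-x) = -f x)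
    (hAB : Set.MapsTo f A B) : genus A ≤ genus B := by
  refine le_iInf₂ fun m hm => ?_
  obtain ⟨φ, hφ, hφ', hφ0⟩ := hm
  refine iInf₂_le m ⟨φ ∘ f, hφ.comp hf hAB, fun x hx => ?_, fun x hx => hφ0 _ (hAB hx)⟩
  simp only [Function.comp_apply, hodd x hx, hφ' _ (hAB hx)]

/-- Odd approximation of the points of `G` by combinations of the points of an `r`-net. -/
theorem exists_odd_coeff {E ι : Type*} [NormedAddCommGroup E] [NormedSpace ℝ E] [Fintype ι]
    (e : ι → E) {G : Set E} {r : ℝ}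
    (hr : ∀ x ∈ G, ∃ i, ‖x - e i‖ < r) :
    ∃ c : E → ι → ℝ, ContinuousOn c G ∧ (∀ x, c (-x) = -c x) ∧
      ∀ x ∈ G, ∑ i, |c x i| ≤ 1 ∧ ‖x - ∑ i, c x i • e i‖ ≤ r := by
  -- Hat functions supported in the `r`-balls around the net points. The sum `W` is even, and it is
  -- positive on `G` because of the net property.
  set w : ι → E → ℝ := fun i x => max 0 (r - ‖x - e i‖) with hw
  set W : E → ℝ := fun x => ∑ i, (w i x + w i (-x)) with hW
  have hwc : ∀ i, Continuous (w i) := fun i => by simp only [hw]; fun_prop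
  have hw0 : ∀ i x, 0 ≤ w i x := fun i x => le_max_left _ _
  have hWpos : ∀ x ∈ G, 0 < W x := by
    intro x hx
    obtain ⟨i, hi⟩ := hr x hx
    have h1 : 0 < w i x := lt_max_of_lt_right (by linarith)
    exact Finset.sum_pos' (fun j _ => add_nonneg (hw0 _ _) (hw0 _ _))
      ⟨i, Finset.mem_univ _, add_pos_of_pos_of_nonneg h1 (hw0 _ _)⟩
  have hWneg : ∀ x, W (-x) = W x := fun x => by
    simp only [hW, neg_neg]
    exact Finset.sum_congr rfl fun i _ => add_comm _ _
  refine ⟨fun x i => (w i x - w i (-x)) / W x, ?_, ?_, ?_⟩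
  · refine continuousOn_pi.2 fun i => ContinuousOn.div ?_ ?_ fun x hx => (hWpos x hx).ne'
    · exact ((hwc i).sub ((hwc i).comp continuous_neg)).continuousOn
    · exact (continuous_finsetSum _ fun i _ =>
        (hwc i).add ((hwc i).comp continuous_neg)).continuousOn
  · intro x
    funext i
    simp only [hWneg, neg_neg, Pi.neg_apply]
    ring
  · intro x hx
    have hWx := hWpos x hx
    refine ⟨?_, ?_⟩
    · simp only [abs_div, abs_of_pos hWx]
      rw [← Finset.sum_div, div_le_one hWx]
      refine Finset.sum_le_sum fun i _ => ?_
      rw [abs_le]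
      constructor <;> linarith [hw0 i x, hw0 i (-x)]
    · have key : ∀ i (y : E), w i y * ‖y - e i‖ ≤ w i y * r := by
        intro i y
        rcases le_total (r - ‖y - e i‖) 0 with h | h
        · simp [hw, max_eq_left h]
        · exact mul_le_mul_of_nonneg_left (by linarith) (hw0 i y)
      -- The error is a weighted mean of the vectors `x - e i` and `-(-x - e i)`, and a weight is
      -- nonzero only where the corresponding vector is shorter than `r`.
      have h1 : x - ∑ i, ((w i x - w i (-x)) / W x) • e i =
          (W x)⁻¹ • ∑ i, (w i x • (x - e i) - w i (-x) • (-x - e i)) := by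
        rw [eq_inv_smul_iff₀ hWx.ne', smul_sub, Finset.smul_sum]
        conv_lhs => rw [hW]
        dsimp only
        rw [Finset.sum_smul, ← Finset.sum_sub_distrib]
        refine Finset.sum_congr rfl fun i _ => ?_
        rw [smul_smul, show (∑ i, (w i x + w i (-x))) = W x from rfl,
          mul_div_cancel₀ _ hWx.ne']
        module
      rw [h1, norm_smul, norm_inv, Real.norm_of_nonneg hWx.le, inv_mul_le_iff₀ hWx]
      refine (norm_sum_le _ _).trans ?_
      simp only [hW]
      rw [Finset.sum_mul]
      refine Finset.sum_le_sum fun i _ => (norm_sub_le _ _).trans ?_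
      rw [norm_smul, norm_smul, Real.norm_of_nonneg (hw0 _ _), Real.norm_of_nonneg (hw0 _ _),
        add_mul]
      exact add_le_add (key i x) (key i (-x))

theorem isCompact_l1_ball (ι : Type*) [Fintype ι] :
    IsCompact {c : ι → ℝ | ∑ i, |c i| ≤ 1} := by
  refine Metric.isCompact_of_isClosed_isBounded ?_ ?_
  · exact isClosed_le (by fun_prop) continuous_const
  · refine isBounded_iff_forall_norm_le.2 ⟨1, fun c hc => ?_⟩
    refine (pi_norm_le_iff_of_nonneg zero_le_one).2 fun i => le_trans ?_ hc
    exact Finset.single_le_sum (f := fun i => |c i|) (fun i _ => abs_nonneg _) (Finset.mem_univ i)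

section

variable {N : ℕ} {s p : ℝ} [Fact (1 ≤ p)] {Ω : Set (EuclideanSpace ℝ (Fin N))}

/-- A symmetric set of genus at least `k` in the unit sphere of `L^p` that lies in the
`r`-neighbourhood (in `L^p`) of finitely many functions gives a bound of the `k`-th eigenvalue by
the energies of these functions. -/
theorem eigenvalue_le_of_net {α β : ℝ} (hα : 0 < α)
    {a : EuclideanSpace ℝ (Fin N) × EuclideanSpace ℝ (Fin N) → ℝ} (ha : a ∈ kernelClass N α β)
    {k : ℕ} {G : Set (W0 N s p Ω)} (hG : G ∈ genusClass N s p Ω k) {ι : Type*} [Fintype ι]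
    (e : ι → W0 N s p Ω) {r : ℝ} (hr1 : r < 1)
    (hr : ∀ u ∈ G, ∃ i, ‖W0.toLp u - W0.toLp (e i)‖ < r) {M : ℝ≥0∞}
    (hM : ∀ i, W0.rootEnergy a (e i) ≤ M) :
    eigenvalue s p Ω a k ≤ M / ENNReal.ofReal (1 - r) := by
  obtain ⟨hGs, -, -, hG1, hGk⟩ := hG
  obtain ⟨c, hc, hodd, hcr⟩ := exists_odd_coeff (fun i => W0.toLp (e i)) (G := W0.toLp '' G)
    (by rintro _ ⟨u, hu, rfl⟩; exact hr u hu)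
  set L : (ι → ℝ) → W0 N s p Ω := fun t => ∑ i, t i • e i with hL
  have hLc : Continuous L := by
    simp only [hL]
    exact continuous_finsetSum _ fun i _ => (continuous_apply i).smul continuous_const
  have hLneg : ∀ t, L (-t) = -L t := fun t => by simp [hL]
  set nrm : W0 N s p Ω → W0 N s p Ω := fun v => ‖W0.toLp v‖⁻¹ • v with hnrm
  have hnrm_neg : ∀ v, nrm (-v) = -nrm v := fun v => by simp [hnrm]
  -- Taking this whole set instead of the image of `G` gives compactness in `W_0^{s,p}(Ω)`, hence a
  -- closed bounded competitor; the lower norm bound keeps normalization continuous.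
  set K₀ : Set (W0 N s p Ω) := L '' {t | ∑ i, |t i| ≤ 1} ∩ {v | 1 - r ≤ ‖W0.toLp v‖} with hK₀
  have hK₀c : IsCompact K₀ := ((isCompact_l1_ball ι).image hLc).inter_right
    (isClosed_le continuous_const W0.continuous_toLp.norm)
  have hK₀pos : ∀ v ∈ K₀, 0 < ‖W0.toLp v‖ := fun v hv => lt_of_lt_of_le (by linarith) hv.2
  have hnrmc : ContinuousOn nrm K₀ :=
    ((W0.continuous_toLp.norm.continuousOn).inv₀ fun v hv => (hK₀pos v hv).ne').smul
      continuousOn_id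
  have hKc : IsCompact (nrm '' K₀) := hK₀c.image_of_continuousOn hnrmc
  have hmaps : Set.MapsTo (fun u => L (c (W0.toLp u))) G K₀ := by
    intro u hu
    obtain ⟨h1, h2⟩ := hcr _ ⟨u, hu, rfl⟩
    refine ⟨⟨_, h1, rfl⟩, ?_⟩
    have h3 : W0.toLp (L (c (W0.toLp u))) = ∑ i, c (W0.toLp u) i • W0.toLp (e i) := by
      simp [hL, map_sum]
    show 1 - r ≤ ‖W0.toLp (L (c (W0.toLp u)))‖
    rw [h3]
    have h4 := norm_sub_norm_le (W0.toLp u) (∑ i, c (W0.toLp u) i • W0.toLp (e i))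
    rw [hG1 u hu] at h4
    linarith
  -- Closeness is known only in `L^p`, but the map factors through finitely many coefficients, so it
  -- is continuous for the `W^{s,p}` norm on both sides.
  have hcG : ContinuousOn (fun u => L (c (W0.toLp u))) G :=
    hLc.comp_continuousOn (hc.comp W0.continuous_toLp.continuousOn (Set.mapsTo_image _ _))
  have hmem : nrm '' K₀ ∈ genusClass N s p Ω k := by
    refine ⟨?_, hKc.isClosed, hKc.isBounded, ?_, hGk.trans ?_⟩
    · rintro _ ⟨v, ⟨⟨t, ht, rfl⟩, hv⟩, rfl⟩
      refine ⟨-L t, ⟨⟨-t, ?_, hLneg t⟩, ?_⟩, hnrm_neg _⟩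
      · simpa using ht
      · simpa using hv
    · rintro _ ⟨v, hv, rfl⟩
      simp only [hnrm, map_smul, norm_smul, norm_inv, norm_norm]
      exact inv_mul_cancel₀ (hK₀pos v hv).ne'
    · refine genus_le_genus (fun u => nrm (L (c (W0.toLp u)))) (hnrmc.comp hcG hmaps) ?_ ?_
      · intro u hu
        simp only [map_neg, hodd, hLneg, hnrm_neg]
      · exact fun u hu => ⟨_, hmaps hu, rfl⟩
  rw [eigenvalue_eq]
  refine (iInf₂_le _ hmem).trans (iSup₂_le ?_)
  rintro _ ⟨_, ⟨⟨t, ht, rfl⟩, hv⟩, rfl⟩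
  have hr0 : 0 < 1 - r := by linarith
  have h5 : W0.rootEnergy a (L t) ≤ M := by
    calc W0.rootEnergy a (L t) ≤ ∑ i, W0.rootEnergy a (t i • e i) :=
          W0.rootEnergy_sum_le hα ha _ _
      _ ≤ ∑ i, ENNReal.ofReal |t i| * M := by
          refine Finset.sum_le_sum fun i _ => ?_
          rw [W0.rootEnergy_smul hα ha, Real.enorm_eq_ofReal_abs]
          gcongr
          exact hM i
      _ = ENNReal.ofReal (∑ i, |t i|) * M := by
          rw [← Finset.sum_mul, ENNReal.ofReal_sum_of_nonneg fun i _ => abs_nonneg _]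
      _ ≤ 1 * M := by
          gcongr
          simpa using ENNReal.ofReal_le_ofReal ht
      _ = M := one_mul M
  have hv' : 1 - r ≤ ‖W0.toLp (L t)‖ := hv
  have h6 : ‖‖W0.toLp (L t)‖⁻¹‖ₑ = (ENNReal.ofReal ‖W0.toLp (L t)‖)⁻¹ := by
    rw [Real.enorm_of_nonneg (by positivity), ENNReal.ofReal_inv_of_pos (by linarith)]
  simp only [hnrm]
  rw [W0.rootEnergy_smul hα ha, h6, mul_comm, ← div_eq_mul_inv]
  exact ENNReal.div_le_div h5 (ENNReal.ofReal_le_ofReal hv')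

end

/-! ### Compactness in `L^p` through averages on small cubes. -/

/-- For every `η > 0` there is a countable partition of `ℝ^N` into cubes of a common volume `v` and
diameter at most `d` with `2 d ^ (N + s p) / v ≤ η`. -/
theorem exists_cube_partition (N : ℕ) {t : ℝ} (ht : (N : ℝ) < t) {η : ℝ≥0∞} (hη : 0 < η) :
    ∃ (Q : (Fin N → ℤ) → Set (EuclideanSpace ℝ (Fin N))) (v : ℝ≥0∞) (d : ℝ),
      (∀ j, MeasurableSet (Q j)) ∧ Pairwise (Function.onFun Disjoint Q) ∧ (⋃ j, Q j) = Set.univ ∧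
      (∀ j, volume (Q j) = v) ∧ v ≠ 0 ∧ v ≠ ∞ ∧ 0 ≤ d ∧
      (∀ j, ∀ x ∈ Q j, ∀ y ∈ Q j, ‖x - y‖ ≤ d) ∧ 2 * v⁻¹ * ENNReal.ofReal (d ^ t) ≤ η := by
  -- For side `h`, volume `h ^ N` and diameter bound `√N * h`, this is the quantity to be bounded;
  -- it tends to `0` with `h` because `t > N`.
  obtain ⟨h, hh, hsmall⟩ : ∃ h : ℝ, 0 < h ∧
      ENNReal.ofReal (2 * (√N) ^ t * h ^ (t - N)) ≤ η := by
    have h1 : Tendsto (fun h : ℝ => ENNReal.ofReal (2 * (√N) ^ t * h ^ (t - N))) (𝓝[>] 0)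
        (𝓝 (ENNReal.ofReal (2 * (√N) ^ t * 0 ^ (t - N)))) := by
      refine ENNReal.tendsto_ofReal (Tendsto.const_mul _ ?_)
      refine ((Real.continuousAt_rpow_const 0 (t - N) (Or.inr (by linarith))).tendsto).mono_left
        nhdsWithin_le_nhds
    rw [Real.zero_rpow (by linarith), mul_zero, ENNReal.ofReal_zero] at h1
    obtain ⟨h, h2, h3⟩ := ((h1.eventually (gt_mem_nhds hη)).and self_mem_nhdsWithin).exists
    exact ⟨h, h3, h2.le⟩
  set Q : (Fin N → ℤ) → Set (EuclideanSpace ℝ (Fin N)) := fun j =>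
    WithLp.ofLp ⁻¹' Set.univ.pi fun i => Set.Ico (j i * h) ((j i + 1) * h) with hQ
  have hmem : ∀ j x, x ∈ Q j ↔ ∀ i, j i * h ≤ x i ∧ x i < (j i + 1) * h := by
    intro j x
    simp [hQ, Set.mem_pi]
  have hfloor : ∀ j x, x ∈ Q j ↔ ∀ i, ⌊x i / h⌋ = j i := by
    intro j x
    rw [hmem]
    refine forall_congr' fun i => ?_
    rw [Int.floor_eq_iff, le_div_iff₀ hh, div_lt_iff₀ hh]
  have hvol : ∀ j, volume (Q j) = ENNReal.ofReal h ^ N := by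
    intro j
    rw [hQ]
    dsimp only
    rw [(PiLp.volume_preserving_ofLp (Fin N)).measure_preimage
      (MeasurableSet.univ_pi fun i => measurableSet_Ico).nullMeasurableSet, volume_pi,
      Measure.pi_pi]
    simp only [Real.volume_Ico, ← sub_mul]
    simp
  refine ⟨Q, ENNReal.ofReal h ^ N, √N * h, ?_, ?_, ?_, hvol, ?_, ?_, by positivity, ?_, ?_⟩
  · intro j
    exact (PiLp.volume_preserving_ofLp (Fin N)).measurable
      (MeasurableSet.univ_pi fun i => measurableSet_Ico)
  · intro j j' hjj'
    refine Set.disjoint_left.2 fun x hx hx' => hjj' ?_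
    rw [hfloor] at hx hx'
    exact funext fun i => (hx i).symm.trans (hx' i)
  · refine Set.eq_univ_of_forall fun x => Set.mem_iUnion.2 ⟨fun i => ⌊x i / h⌋, ?_⟩
    rw [hfloor]
    exact fun i => rfl
  · exact pow_ne_zero _ (by simpa using hh)
  · exact ENNReal.pow_ne_top ENNReal.ofReal_ne_top
  · intro j x hx y hy
    rw [hmem] at hx hy
    rw [EuclideanSpace.norm_eq]
    calc √(∑ i, ‖(x - y) i‖ ^ 2) ≤ √(∑ _i : Fin N, h ^ 2) := by
          refine Real.sqrt_le_sqrt (Finset.sum_le_sum fun i _ => ?_)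
          refine pow_le_pow_left₀ (norm_nonneg _) ?_ 2
          rw [Real.norm_eq_abs, PiLp.sub_apply, abs_le]
          constructor <;> nlinarith [hx i, hy i]
      _ = √N * h := by
          rw [Finset.sum_const, Finset.card_univ, Fintype.card_fin, nsmul_eq_mul,
            Real.sqrt_mul (by positivity), Real.sqrt_sq hh.le]
  · refine le_trans (le_of_eq ?_) hsmall
    rw [← ENNReal.ofReal_pow hh.le, ← ENNReal.ofReal_inv_of_pos (by positivity),
      ← ENNReal.ofReal_ofNat 2, ← ENNReal.ofReal_mul (by positivity),
      ← ENNReal.ofReal_mul (by positivity)]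
    congr 1
    rw [Real.mul_rpow (by positivity) hh.le, Real.rpow_sub hh, Real.rpow_natCast]
    field_simp

/-- Jensen's inequality, obtained from the monotonicity of `L^p` norms in the exponent on a
probability space. -/
theorem enorm_sub_integral_rpow_le {X : Type*} [MeasurableSpace X] {μ : Measure X}
    [IsProbabilityMeasure μ] {p : ℝ} (hp : 1 ≤ p) {u : X → ℝ} (hu : Integrable u μ) (c : ℝ) :
    ‖c - ∫ y, u y ∂μ‖ₑ ^ p ≤ ∫⁻ y, ‖c - u y‖ₑ ^ p ∂μ := by
  have hp0 : 0 < p := by linarith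
  have h1 : c - ∫ y, u y ∂μ = ∫ y, (c - u y) ∂μ := by
    rw [integral_sub (integrable_const c) hu]
    simp
  have h2 : ‖c - ∫ y, u y ∂μ‖ₑ ≤ eLpNorm (fun y => c - u y) (ENNReal.ofReal p) μ := by
    rw [h1]
    refine (enorm_integral_le_lintegral_enorm _).trans ?_
    rw [← eLpNorm_one_eq_lintegral_enorm]
    exact eLpNorm_le_eLpNorm_of_exponent_le (by simpa using hp)
      (aestronglyMeasurable_const.sub hu.1)
  rw [eLpNorm_eq_lintegral_rpow_enorm_toReal (by simpa using hp0) ENNReal.ofReal_ne_top,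
    ENNReal.toReal_ofReal hp0.le] at h2
  calc _ ≤ ((∫⁻ y, ‖c - u y‖ₑ ^ p ∂μ) ^ (1 / p)) ^ p := ENNReal.rpow_le_rpow h2 hp0.le
    _ = _ := by rw [one_div, ENNReal.rpow_inv_rpow hp0.ne']

/-- Inside `Q` the singular weight is at least `d ^ (-(N + s p))`; on the diagonal the numerator
vanishes. -/
theorem lintegral_lintegral_sub_le {N : ℕ} {s p : ℝ} (hs : 0 < s) (hp : 1 ≤ p)
    {u : EuclideanSpace ℝ (Fin N) → ℝ}
    (hu : AEStronglyMeasurable u volume) {Q : Set (EuclideanSpace ℝ (Fin N))}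
    (hQ : MeasurableSet Q) {d : ℝ} (hd : 0 ≤ d) (hQd : ∀ x ∈ Q, ∀ y ∈ Q, ‖x - y‖ ≤ d) :
    ∫⁻ x in Q, ∫⁻ y in Q, ‖u x - u y‖ₑ ^ p ≤ ENNReal.ofReal (d ^ ((N : ℝ) + s * p)) *
      ∫⁻ z in Q ×ˢ Q, ENNReal.ofReal (|u z.1 - u z.2| ^ p / ‖z.1 - z.2‖ ^ ((N : ℝ) + s * p)) := by
  have hp0 : 0 < p := by linarith
  have hm : AEMeasurable (fun z : EuclideanSpace ℝ (Fin N) × EuclideanSpace ℝ (Fin N) =>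
      ‖u z.1 - u z.2‖ₑ ^ p) ((volume.restrict Q).prod (volume.restrict Q)) := by
    rw [Measure.prod_restrict]
    have h1 : AEStronglyMeasurable
        (fun z : EuclideanSpace ℝ (Fin N) × EuclideanSpace ℝ (Fin N) => u z.1) volume :=
      hu.comp_quasiMeasurePreserving Measure.quasiMeasurePreserving_fst
    have h2 : AEStronglyMeasurable
        (fun z : EuclideanSpace ℝ (Fin N) × EuclideanSpace ℝ (Fin N) => u z.2) volume :=
      hu.comp_quasiMeasurePreserving Measure.quasiMeasurePreserving_snd
    exact ((h1.sub h2).enorm.pow_const _).restrict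
  rw [← lintegral_prod (fun z : EuclideanSpace ℝ (Fin N) × EuclideanSpace ℝ (Fin N) =>
    ‖u z.1 - u z.2‖ₑ ^ p) hm, Measure.prod_restrict,
    ← lintegral_const_mul' _ _ ENNReal.ofReal_ne_top]
  refine setLIntegral_mono_ae' (hQ.prod hQ) (ae_of_all _ fun z hz => ?_)
  have hz' := hQd z.1 hz.1 z.2 hz.2
  rw [Real.enorm_eq_ofReal_abs, ENNReal.ofReal_rpow_of_nonneg (abs_nonneg _) hp0.le,
    ← ENNReal.ofReal_mul (by positivity)]
  refine ENNReal.ofReal_le_ofReal ?_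
  rcases eq_or_ne z.1 z.2 with h | h
  · simp [h, Real.zero_rpow hp0.ne']
  · have h3 : 0 < ‖z.1 - z.2‖ := norm_pos_iff.2 (sub_ne_zero.2 h)
    rw [← mul_div_assoc, le_div_iff₀ (by positivity), mul_comm]
    exact mul_le_mul_of_nonneg_right (Real.rpow_le_rpow h3.le hz' (by positivity)) (by positivity)

theorem lintegral_sub_average_le {N : ℕ} {p : ℝ} (hp : 1 ≤ p)
    {u : EuclideanSpace ℝ (Fin N) → ℝ} (hu : MemLp u (ENNReal.ofReal p) volume) {Q : Set (EuclideanSpace ℝ (Fin N))}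
    (h0 : volume Q ≠ 0) (ht : volume Q ≠ ∞) :
    ∫⁻ x in Q, ‖u x - ∫ y, u y ∂(volume Q)⁻¹ • volume.restrict Q‖ₑ ^ p ≤
      (volume Q)⁻¹ * ∫⁻ x in Q, ∫⁻ y in Q, ‖u x - u y‖ₑ ^ p := by
  have : IsProbabilityMeasure ((volume Q)⁻¹ • volume.restrict Q) :=
    ⟨by simp [ENNReal.inv_mul_cancel h0 ht]⟩
  have hint : Integrable u ((volume Q)⁻¹ • volume.restrict Q) := by
    refine MemLp.integrable (q := ENNReal.ofReal p) (by simpa using hp) ?_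
    exact hu.restrict Q |>.smul_measure (ENNReal.inv_ne_top.2 h0)
  rw [← lintegral_const_mul' _ _ (ENNReal.inv_ne_top.2 h0)]
  refine lintegral_mono fun x => ?_
  refine (enorm_sub_integral_rpow_le hp hint (u x)).trans (le_of_eq ?_)
  rw [lintegral_smul_measure, smul_eq_mul]

/-- A Poincaré inequality without subtracting a mean: `u` vanishes on at least half of `Q`, so `u x
= u x - u y` for all `y` in that half. -/
theorem lintegral_le_of_large_complement {N : ℕ} {p : ℝ}
    {u : EuclideanSpace ℝ (Fin N) → ℝ} {Ω : Set (EuclideanSpace ℝ (Fin N))} (hΩ : MeasurableSet Ω)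
    (huΩ : ∀ᵐ x, x ∉ Ω → u x = 0) {Q : Set (EuclideanSpace ℝ (Fin N))} (hQ : MeasurableSet Q)
    (h0 : volume Q ≠ 0) (ht : volume Q ≠ ∞) (hQΩ : volume (Q ∩ Ω) ≤ volume Q / 2) :
    ∫⁻ x in Q, ‖u x‖ₑ ^ p ≤
      2 * (volume Q)⁻¹ * ∫⁻ x in Q, ∫⁻ y in Q, ‖u x - u y‖ₑ ^ p := by
  have hne : 2 * (volume Q)⁻¹ ≠ ∞ := ENNReal.mul_ne_top (by simp) (ENNReal.inv_ne_top.2 h0)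
  have hA : volume Q / 2 ≤ volume (Q \ Ω) := by
    have h1 := measure_inter_add_sdiff (μ := volume) Q hΩ
    by_contra! h2
    have h3 : volume (Q ∩ Ω) + volume (Q \ Ω) < volume Q / 2 + volume Q / 2 :=
      ENNReal.add_lt_add_of_le_of_lt (ne_top_of_le_ne_top ht
        (measure_mono Set.inter_subset_left)) hQΩ h2
    rw [h1, ENNReal.add_halves] at h3
    exact lt_irrefl _ h3
  rw [← lintegral_const_mul' _ _ hne]
  refine lintegral_mono fun x => ?_
  calc ‖u x‖ₑ ^ p = 2 * (volume Q)⁻¹ * (‖u x‖ₑ ^ p * (volume Q / 2)) := by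
        rw [div_eq_mul_inv, show 2 * (volume Q)⁻¹ * (‖u x‖ₑ ^ p * (volume Q * 2⁻¹)) =
          ((volume Q)⁻¹ * volume Q) * (2 * 2⁻¹) * ‖u x‖ₑ ^ p by ring,
          ENNReal.inv_mul_cancel h0 ht, ENNReal.mul_inv_cancel (by simp) (by simp)]
        simp
    _ ≤ 2 * (volume Q)⁻¹ * (‖u x‖ₑ ^ p * volume (Q \ Ω)) := by gcongr
    _ = 2 * (volume Q)⁻¹ * ∫⁻ y in Q \ Ω, ‖u x - u y‖ₑ ^ p := by
        congr 1
        rw [← setLIntegral_const]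
        refine setLIntegral_congr_fun_ae (hQ.diff hΩ) (huΩ.mono fun y hy hyQ => ?_)
        rw [hy hyQ.2, sub_zero]
    _ ≤ _ := by
        gcongr
        exact Set.sdiff_subset

/-- Elements of `W_0^{s,p}(Ω)` are uniformly close in `L^p` to a finite-dimensional space. -/
theorem exists_finiteDimensional_approx {N : ℕ} {s p : ℝ} (hs : 0 < s) [hp : Fact (1 ≤ p)]
    {Ω : Set (EuclideanSpace ℝ (Fin N))} (hΩ : MeasurableSet Ω) (hΩfin : volume Ω < ∞)
    {η : ℝ≥0∞} (hη : 0 < η) :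
    ∃ V : Submodule ℝ (Lp ℝ (ENNReal.ofReal p) (volume : Measure (EuclideanSpace ℝ (Fin N)))),
      FiniteDimensional ℝ V ∧ ∀ u : W0 N s p Ω, ∃ w ∈ V,
        ENNReal.ofReal ‖W0.toLp u - w‖ ≤ η ^ (1 / p) * ENNReal.ofReal (W0.semi u) := by
  classical
  have hp1 : 1 ≤ p := hp.out
  have hp0 : 0 < p := by linarith
  obtain ⟨Q, v, d, hQm, hQd, hQu, hQv, hv0, hvt, hd0, hd, hη'⟩ :=
    exists_cube_partition N (t := N + s * p) (by nlinarith) hη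
  -- Only finitely many cubes can be at least half filled by `Ω`, which has finite measure. On these
  -- `u` is replaced by its mean, on all others by `0`.
  have hfin : {j | v / 2 ≤ volume (Q j ∩ Ω)}.Finite := by
    refine Measure.finite_const_le_meas_of_disjoint_iUnion volume
      (ENNReal.div_pos hv0 (by simp)) (fun j => (hQm j).inter hΩ) (fun i j hij => ?_) ?_
    · exact (hQd hij).mono Set.inter_subset_left Set.inter_subset_left
    · rw [← Set.iUnion_inter, hQu, Set.univ_inter]
      exact hΩfin.ne
  set J := hfin.toFinset with hJ
  set e : (Fin N → ℤ) → Lp ℝ (ENNReal.ofReal p)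
      (volume : Measure (EuclideanSpace ℝ (Fin N))) := fun j =>
    indicatorConstLp (ENNReal.ofReal p) (hQm j) (by rw [hQv]; exact hvt) 1 with he
  refine ⟨Submodule.span ℝ (J.image e : Finset _), inferInstance, fun u => ?_⟩
  set m : (Fin N → ℤ) → ℝ := fun j =>
    ∫ y, W0.toLp u y ∂(volume (Q j))⁻¹ • volume.restrict (Q j) with hm
  set w := ∑ j ∈ J, m j • e j with hw
  refine ⟨w, Submodule.sum_mem _ fun j hj => Submodule.smul_mem _ _ (Submodule.subset_span ?_), ?_⟩
  · exact Finset.mem_coe.2 (Finset.mem_image_of_mem e hj)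
  have hwae : ∀ᵐ x, w x = ∑ j ∈ J, m j * (Q j).indicator (fun _ => (1 : ℝ)) x := by
    have h1 := Lp.coeFn_finsetSum J fun j => m j • e j
    have h2 : ∀ᵐ x, ∀ j ∈ J, (m j • e j) x = m j * (Q j).indicator (fun _ => (1 : ℝ)) x := by
      refine (Finset.eventually_all J).2 fun j _ => ?_
      filter_upwards [Lp.coeFn_smul (m j) (e j), indicatorConstLp_coeFn (p := ENNReal.ofReal p)
        (hs := hQm j) (hμs := by rw [hQv]; exact hvt) (c := (1 : ℝ))] with x h3 h4
      rw [h3, Pi.smul_apply, smul_eq_mul, h4]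
    filter_upwards [h1, h2] with x h3 h4
    rw [hw, h3, Finset.sum_apply]
    exact Finset.sum_congr rfl h4
  have hwQ : ∀ j, ∀ᵐ x, x ∈ Q j → w x = if j ∈ J then m j else 0 := by
    intro j
    filter_upwards [hwae] with x hx hxj
    have h5 : ∀ i, i ≠ j → (Q i).indicator (fun _ => (1 : ℝ)) x = 0 := fun i hi =>
      Set.indicator_of_notMem (fun hxi => Set.disjoint_left.1 (hQd hi) hxi hxj) _
    rw [hx]
    split_ifs with hj
    · rw [Finset.sum_eq_single_of_mem j hj fun i _ hi => by rw [h5 i hi, mul_zero],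
        Set.indicator_of_mem hxj, mul_one]
    · refine Finset.sum_eq_zero fun i hi => ?_
      rw [h5 i (fun h => hj (h ▸ hi)), mul_zero]
  set D : ℝ≥0∞ := ENNReal.ofReal (d ^ ((N : ℝ) + s * p)) with hD
  set κ : EuclideanSpace ℝ (Fin N) × EuclideanSpace ℝ (Fin N) → ℝ≥0∞ := fun z =>
    ENNReal.ofReal (|W0.toLp u z.1 - W0.toLp u z.2| ^ p / ‖z.1 - z.2‖ ^ ((N : ℝ) + s * p)) with hκ
  have hlocal : ∀ j, ∫⁻ x in Q j, ‖W0.toLp u x - w x‖ₑ ^ p ≤ η * ∫⁻ z in Q j ×ˢ Q j, κ z := by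
    intro j
    have h0 : volume (Q j) ≠ 0 := by rwa [hQv]
    have ht : volume (Q j) ≠ ∞ := by rwa [hQv]
    have h6 := lintegral_lintegral_sub_le hs hp1 (Lp.aestronglyMeasurable (W0.toLp u)) (hQm j)
      hd0 (hd j)
    have h7 : ∫⁻ x in Q j, ‖W0.toLp u x - w x‖ₑ ^ p ≤ 2 * (volume (Q j))⁻¹ *
        ∫⁻ x in Q j, ∫⁻ y in Q j, ‖W0.toLp u x - W0.toLp u y‖ₑ ^ p := by
      by_cases hj : j ∈ J
      · rw [setLIntegral_congr_fun_ae (g := fun x => ‖W0.toLp u x - m j‖ₑ ^ p) (hQm j)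
          ((hwQ j).mono fun x hx hxj => by rw [hx hxj, if_pos hj])]
        refine (lintegral_sub_average_le hp1 (Lp.memLp (W0.toLp u)) h0 ht).trans ?_
        gcongr
        exact le_mul_of_one_le_left zero_le (by norm_num)
      · rw [setLIntegral_congr_fun_ae (g := fun x => ‖W0.toLp u x‖ₑ ^ p) (hQm j)
          ((hwQ j).mono fun x hx hxj => by rw [hx hxj, if_neg hj, sub_zero])]
        refine lintegral_le_of_large_complement hΩ u.2.2 (hQm j) h0 ht ?_
        simp only [hJ, Set.Finite.mem_toFinset, Set.mem_ofPred_eq, not_le] at hj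
        rw [hQv]
        exact hj.le
    refine h7.trans ?_
    rw [hQv]
    calc _ ≤ 2 * v⁻¹ * (D * ∫⁻ z in Q j ×ˢ Q j, κ z) := by gcongr
      _ = 2 * v⁻¹ * D * ∫⁻ z in Q j ×ˢ Q j, κ z := by ring
      _ ≤ _ := by gcongr
  have hglobal : ∫⁻ x, ‖W0.toLp u x - w x‖ₑ ^ p ≤ η * ∫⁻ z, κ z := by
    calc ∫⁻ x, ‖W0.toLp u x - w x‖ₑ ^ p
        = ∑' j, ∫⁻ x in Q j, ‖W0.toLp u x - w x‖ₑ ^ p := by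
          rw [← lintegral_iUnion hQm hQd, hQu, setLIntegral_univ]
      _ ≤ ∑' j, η * ∫⁻ z in Q j ×ˢ Q j, κ z := ENNReal.tsum_le_tsum hlocal
      -- The diagonal blocks are disjoint, so the local bounds add up to at most the full seminorm.
      _ = η * ∫⁻ z in ⋃ j, Q j ×ˢ Q j, κ z := by
          rw [ENNReal.tsum_mul_left, lintegral_iUnion fun j => (hQm j).prod (hQm j)]
          intro i j hij
          exact Set.disjoint_prod.2 (Or.inl (hQd hij))
      _ ≤ _ := by
          gcongr
          exact Measure.restrict_le_self
  rw [W0.ofReal_semi, ofReal_norm, Lp.enorm_def,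
    eLpNorm_eq_lintegral_rpow_enorm_toReal (by simpa using hp0) ENNReal.ofReal_ne_top,
    ENNReal.toReal_ofReal hp0.le, gagliardo, ← ENNReal.mul_rpow_of_nonneg _ _ (by positivity)]
  refine ENNReal.rpow_le_rpow (le_trans (le_of_eq ?_) hglobal) (by positivity)
  refine lintegral_congr_ae ((Lp.coeFn_sub (W0.toLp u) w).mono fun x hx => ?_)
  dsimp only
  rw [hx, Pi.sub_apply]

/-- The fractional Rellich theorem on sets of finite measure. -/
theorem totallyBounded_image_toLp {N : ℕ} {s p : ℝ} (hs : 0 < s) [hp : Fact (1 ≤ p)]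
    {Ω : Set (EuclideanSpace ℝ (Fin N))} (hΩ : MeasurableSet Ω) (hΩfin : volume Ω < ∞) (M : ℝ) :
    TotallyBounded (W0.toLp '' {u : W0 N s p Ω | ‖W0.toLp u‖ ≤ 1 ∧ W0.semi u ≤ M}) := by
  have hp0 : 0 < p := by linarith [hp.out]
  rw [Metric.totallyBounded_iff]
  intro ε hε
  set δ : ℝ := ε / 2 / (|M| + 1) with hδ
  have hδ0 : 0 < δ := by positivity
  obtain ⟨V, hV, hVu⟩ := exists_finiteDimensional_approx (N := N) (p := p) hs hΩ hΩfin
    (η := ENNReal.ofReal δ ^ p) (ENNReal.rpow_pos (by simpa using hδ0) ENNReal.ofReal_ne_top)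
  have hclose : ∀ u : W0 N s p Ω, W0.semi u ≤ M → ∃ w ∈ V, ‖W0.toLp u - w‖ < ε / 2 := by
    intro u hu
    obtain ⟨w, hw, h1⟩ := hVu u
    refine ⟨w, hw, ?_⟩
    rw [one_div, ENNReal.rpow_rpow_inv hp0.ne', ← ENNReal.ofReal_mul hδ0.le,
      ENNReal.ofReal_le_ofReal_iff (mul_nonneg hδ0.le (W0.semi_nonneg u))] at h1
    refine h1.trans_lt ?_
    calc δ * W0.semi u ≤ δ * |M| := by gcongr; exact hu.trans (le_abs_self M)
      _ < δ * (|M| + 1) := by gcongr; linarith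
      _ = ε / 2 := by rw [hδ]; field_simp
  have hK : TotallyBounded ((↑) '' Metric.closedBall (0 : V) (1 + ε / 2) : Set (Lp ℝ
      (ENNReal.ofReal p) (volume : Measure (EuclideanSpace ℝ (Fin N))))) := by
    have := FiniteDimensional.proper ℝ V
    exact ((isCompact_closedBall (0 : V) (1 + ε / 2)).image continuous_subtype_val).totallyBounded
  obtain ⟨t, ht, htK⟩ := Metric.totallyBounded_iff.1 hK (ε / 2) (by positivity)
  refine ⟨t, ht, ?_⟩
  rintro _ ⟨u, ⟨hu1, huM⟩, rfl⟩
  obtain ⟨w, hw, hw'⟩ := hclose u huM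
  have h2 : ‖w‖ ≤ 1 + ε / 2 := by
    have := norm_le_insert (W0.toLp u) w
    linarith
  obtain ⟨y, hy, hy'⟩ := Set.mem_iUnion₂.1 (htK ⟨⟨w, hw⟩, by simpa using h2, rfl⟩)
  refine Set.mem_iUnion₂.2 ⟨y, hy, ?_⟩
  rw [Metric.mem_ball] at hy' ⊢
  calc dist (W0.toLp u) y ≤ dist (W0.toLp u) w + dist w y := dist_triangle _ _ _
    _ < ε / 2 + ε / 2 := add_lt_add (by rwa [dist_eq_norm]) hy'
    _ = ε := add_halves ε

/-- The net points are taken in `S` itself so that they inherit its energy bounds. -/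
theorem exists_finite_net {N : ℕ} {s p : ℝ} (hs : 0 < s) [hp : Fact (1 ≤ p)]
    {Ω : Set (EuclideanSpace ℝ (Fin N))} (hΩ : MeasurableSet Ω) (hΩfin : volume Ω < ∞) {M : ℝ}
    {S : Set (W0 N s p Ω)} (hS1 : ∀ u ∈ S, ‖W0.toLp u‖ = 1) (hSM : ∀ u ∈ S, W0.semi u ≤ M)
    {r : ℝ} (hr : 0 < r) :
    ∃ F : Finset (W0 N s p Ω), (∀ w ∈ F, w ∈ S) ∧
      ∀ u ∈ S, ∃ w ∈ F, ‖W0.toLp u - W0.toLp w‖ < r := by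
  classical
  have hT : TotallyBounded (W0.toLp '' S) := by
    refine (totallyBounded_image_toLp (Ω := Ω) hs hΩ hΩfin M).subset (Set.image_mono ?_)
    exact fun u hu => ⟨(hS1 u hu).le, hSM u hu⟩
  obtain ⟨t, htS, ht, htc⟩ := hT.exists_subset (Metric.dist_mem_uniformity hr)
  have htS' : ∀ y ∈ t, ∃ u, u ∈ S ∧ W0.toLp u = y := fun y hy => htS hy
  choose! g hg hg' using htS'
  refine ⟨ht.toFinset.image g, ?_, fun u hu => ?_⟩
  · intro w hw
    obtain ⟨y, hy, rfl⟩ := Finset.mem_image.1 hw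
    exact hg _ (ht.mem_toFinset.1 hy)
  · obtain ⟨y, hy, hy'⟩ := Set.mem_iUnion₂.1 (htc ⟨u, hu, rfl⟩)
    refine ⟨g y, Finset.mem_image_of_mem g (ht.mem_toFinset.2 hy), ?_⟩
    rw [hg' y hy, ← dist_eq_norm]
    exact hy'

/-! ### Convergence and lower semicontinuity of the energies. -/

theorem aemeasurable_gagliardo_density {N : ℕ} (s p : ℝ) {u : EuclideanSpace ℝ (Fin N) → ℝ}
    (hu : AEStronglyMeasurable u volume) :
    AEMeasurable (fun z : EuclideanSpace ℝ (Fin N) × EuclideanSpace ℝ (Fin N) =>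
      |u z.1 - u z.2| ^ p / ‖z.1 - z.2‖ ^ ((N : ℝ) + s * p)) volume := by
  have h1 : AEMeasurable
      (fun z : EuclideanSpace ℝ (Fin N) × EuclideanSpace ℝ (Fin N) => u z.1) volume :=
    (hu.comp_quasiMeasurePreserving Measure.quasiMeasurePreserving_fst).aemeasurable
  have h2 : AEMeasurable
      (fun z : EuclideanSpace ℝ (Fin N) × EuclideanSpace ℝ (Fin N) => u z.2) volume :=
    (hu.comp_quasiMeasurePreserving Measure.quasiMeasurePreserving_snd).aemeasurable
  have h3 : Measurable fun z : EuclideanSpace ℝ (Fin N) × EuclideanSpace ℝ (Fin N) =>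
      ‖z.1 - z.2‖ ^ ((N : ℝ) + s * p) := by fun_prop
  exact ((h1.sub h2).abs.pow_const p).div h3.aemeasurable

/-- Strong `L^1` convergence of `g j` against weak* convergence of bounded `b j`. -/
theorem tendsto_integral_mul_of_weakStar {N : ℕ} {β : ℝ}
    {b g : ℕ → EuclideanSpace ℝ (Fin N) × EuclideanSpace ℝ (Fin N) → ℝ}
    {b₀ g₀ h : EuclideanSpace ℝ (Fin N) × EuclideanSpace ℝ (Fin N) → ℝ}
    (hbm : ∀ j, AEStronglyMeasurable (b j) volume) (hb : ∀ j, ∀ᵐ z, |b j z| ≤ β)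
    (hconv : WeakStarTendsto b b₀) (hgm : ∀ j, AEStronglyMeasurable (g j) volume)
    (hg₀m : AEStronglyMeasurable g₀ volume) (hh : Integrable h volume)
    (hg : ∀ j z, |g j z| ≤ h z) (hg₀ : ∀ z, |g₀ z| ≤ h z)
    (hlim : ∀ᵐ z, Tendsto (fun j => g j z) atTop (𝓝 (g₀ z))) :
    Tendsto (fun j => ∫ z, b j z * g j z) atTop (𝓝 (∫ z, b₀ z * g₀ z)) := by
  have hg₀i : Integrable g₀ volume := hh.mono' hg₀m (ae_of_all _ hg₀)
  have hgi : ∀ j, Integrable (g j) volume := fun j => hh.mono' (hgm j) (ae_of_all _ (hg j))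
  -- Split `b j * g j = b j * (g j - g₀) + b j * g₀`: dominated convergence handles the first term,
  -- weak* convergence the second.
  have h1 : Tendsto (fun j => ∫ z, b j z * (g j z - g₀ z)) atTop (𝓝 0) := by
    have h2 : Tendsto (fun j => ∫ z, b j z * (g j z - g₀ z)) atTop
        (𝓝 (∫ _z : EuclideanSpace ℝ (Fin N) × EuclideanSpace ℝ (Fin N), (0 : ℝ))) := by
      refine tendsto_integral_of_dominated_convergence (fun z => β * (h z + h z))
        (fun j => (hbm j).mul ((hgm j).sub hg₀m)) ((hh.add hh).const_mul β) ?_ ?_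
      · intro j
        filter_upwards [hb j] with z hz
        rw [Real.norm_eq_abs, abs_mul]
        refine mul_le_mul hz ((abs_sub _ _).trans (add_le_add (hg j z) (hg₀ z)))
          (abs_nonneg _) ((abs_nonneg _).trans hz)
      · filter_upwards [hlim, ae_all_iff.2 hb] with z hz hbz
        have h3 : Tendsto (fun j => β * |g j z - g₀ z|) atTop (𝓝 0) := by
          have := (hz.sub_const (g₀ z)).abs.const_mul β
          simpa using this
        refine squeeze_zero_norm (fun j => ?_) h3
        rw [Real.norm_eq_abs, abs_mul]
        exact mul_le_mul_of_nonneg_right (hbz j) (abs_nonneg _)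
    simpa using h2
  have h4 := h1.add (hconv g₀ hg₀i)
  rw [zero_add] at h4
  refine h4.congr fun j => ?_
  rw [← integral_add]
  · exact integral_congr_ae (ae_of_all _ fun z => by ring)
  · exact ((hgi j).sub hg₀i).bdd_mul (hbm j) (hb j)
  · exact hg₀i.bdd_mul (hbm j) (hb j)

/-- The `Γ`-liminf inequality: along an `L^p` convergent (here: a.e. convergent) sequence, the
energies with respect to weak* convergent kernels are lower semicontinuous. -/
theorem energy_le_of_tendsto_ae {N : ℕ} (s : ℝ) {p : ℝ} (hp : 1 ≤ p) {α β : ℝ} (hα : 0 < α)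
    {b : ℕ → EuclideanSpace ℝ (Fin N) × EuclideanSpace ℝ (Fin N) → ℝ}
    {b₀ : EuclideanSpace ℝ (Fin N) × EuclideanSpace ℝ (Fin N) → ℝ}
    (hb : ∀ j, b j ∈ kernelClass N α β) (hb₀ : b₀ ∈ kernelClass N α β)
    (hconv : WeakStarTendsto b b₀) {u : ℕ → EuclideanSpace ℝ (Fin N) → ℝ}
    {u₀ : EuclideanSpace ℝ (Fin N) → ℝ} (hu : ∀ j, AEStronglyMeasurable (u j) volume)
    (hu₀ : AEStronglyMeasurable u₀ volume)
    (hlim : ∀ᵐ x, Tendsto (fun j => u j x) atTop (𝓝 (u₀ x))) {M : ℝ≥0∞}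
    (hM : ∀ j, energy s p (b j) (u j) ≤ M) : energy s p b₀ u₀ ≤ M := by
  have hp0 : 0 < p := by linarith
  rcases eq_or_ne M ∞ with rfl | hMt
  · exact le_top
  set κ : (EuclideanSpace ℝ (Fin N) → ℝ) →
      EuclideanSpace ℝ (Fin N) × EuclideanSpace ℝ (Fin N) → ℝ := fun v z =>
    |v z.1 - v z.2| ^ p / ‖z.1 - z.2‖ ^ ((N : ℝ) + s * p) with hκ
  have hκ0 : ∀ v z, 0 ≤ κ v z := fun v z => by simp only [hκ]; positivity
  set B : ℕ → Set (EuclideanSpace ℝ (Fin N) × EuclideanSpace ℝ (Fin N)) := fun R =>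
    Metric.ball 0 R with hB
  -- The densities have no common integrable majorant. Cutting height and support at `R` provides
  -- one, and as the kernels are nonnegative it only lowers the energy; Fatou's lemma later removes
  -- the cut.
  set T : ℕ → (EuclideanSpace ℝ (Fin N) → ℝ) →
      EuclideanSpace ℝ (Fin N) × EuclideanSpace ℝ (Fin N) → ℝ := fun R v =>
    (B R).indicator fun z => min (κ v z) R with hT
  have hT0 : ∀ R v z, 0 ≤ T R v z := fun R v z =>
    Set.indicator_nonneg (fun z _ => le_min (hκ0 v z) (Nat.cast_nonneg R)) z
  have hTκ : ∀ R v z, T R v z ≤ κ v z := fun R v z =>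
    Set.indicator_le' (fun z _ => min_le_left _ _) (fun z _ => hκ0 v z) z
  have hTm : ∀ R v, AEStronglyMeasurable v volume → AEStronglyMeasurable (T R v) volume :=
    fun R v hv => (((aemeasurable_gagliardo_density s p hv).min
      aemeasurable_const).aestronglyMeasurable).indicator Metric.isOpen_ball.measurableSet
  have hdom : ∀ R : ℕ, Integrable ((B R).indicator fun _ => (R : ℝ)) volume := fun R =>
    (integrable_indicator_iff Metric.isOpen_ball.measurableSet).2
      (integrableOn_const (Metric.isBounded_ball.measure_lt_top.ne))
  have hTle : ∀ R v z, |T R v z| ≤ (B R).indicator (fun _ => (R : ℝ)) z := fun R v z => by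
    rw [abs_of_nonneg (hT0 R v z)]
    exact Set.indicator_le_indicator (min_le_right _ _)
  have hκlim : ∀ᵐ z, Tendsto (fun j => κ (u j) z) atTop (𝓝 (κ u₀ z)) := by
    have h1 : ∀ᵐ z : EuclideanSpace ℝ (Fin N) × EuclideanSpace ℝ (Fin N),
        Tendsto (fun j => u j z.1) atTop (𝓝 (u₀ z.1)) :=
      Measure.quasiMeasurePreserving_fst.ae hlim
    have h2 : ∀ᵐ z : EuclideanSpace ℝ (Fin N) × EuclideanSpace ℝ (Fin N),
        Tendsto (fun j => u j z.2) atTop (𝓝 (u₀ z.2)) :=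
      Measure.quasiMeasurePreserving_snd.ae hlim
    filter_upwards [h1, h2] with z hz1 hz2
    exact ((hz1.sub hz2).abs.rpow_const (Or.inr hp0.le)).div_const _
  have hTlim : ∀ R, ∀ᵐ z, Tendsto (fun j => T R (u j) z) atTop (𝓝 (T R u₀ z)) := by
    intro R
    filter_upwards [hκlim] with z hz
    by_cases hzB : z ∈ B R
    · simp only [hT, Set.indicator_of_mem hzB]
      exact hz.min tendsto_const_nhds
    · simp only [hT, Set.indicator_of_notMem hzB]
      exact tendsto_const_nhds
  have hbb : ∀ c ∈ kernelClass N α β, ∀ᵐ z, |c z| ≤ β := fun c hc => hc.2.mono fun z hz => by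
    rw [abs_of_nonneg (hα.le.trans hz.2.1)]
    exact hz.2.2
  have hint : ∀ R, ∀ c ∈ kernelClass N α β, ∀ v, AEStronglyMeasurable v volume →
      ENNReal.ofReal (∫ z, c z * T R v z) = ∫⁻ z, ENNReal.ofReal (c z * T R v z) := by
    intro R c hc v hv
    refine ofReal_integral_eq_lintegral_ofReal ?_ ?_
    · exact ((hdom R).mono' (hTm R v hv) (ae_of_all _ (hTle R v))).bdd_mul hc.1.1 (hbb c hc)
    · exact (kernelClass.nonneg hα hc).mono fun z hz => mul_nonneg hz (hT0 R v z)
  have hR : ∀ R, ∫⁻ z, ENNReal.ofReal (b₀ z * T R u₀ z) ≤ M := by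
    intro R
    rw [← hint R b₀ hb₀ u₀ hu₀]
    have h3 := tendsto_integral_mul_of_weakStar (fun j => (hb j).1.1) (fun j => hbb _ (hb j))
      hconv (fun j => hTm R _ (hu j)) (hTm R _ hu₀) (hdom R) (fun j => hTle R (u j))
      (hTle R u₀) (hTlim R)
    refine le_of_tendsto' (ENNReal.tendsto_ofReal h3) fun j => ?_
    rw [hint R _ (hb j) _ (hu j)]
    refine le_trans (lintegral_mono_ae ?_) (hM j)
    filter_upwards [kernelClass.nonneg hα (hb j)] with z hz
    exact ENNReal.ofReal_le_ofReal (mul_le_mul_of_nonneg_left (hTκ R _ z) hz)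
  have hfatou := lintegral_liminf_le' (μ := volume) (u := atTop)
    (f := fun (R : ℕ) z => ENNReal.ofReal (b₀ z * T R u₀ z))
    (fun R => (hb₀.1.1.mul (hTm R _ hu₀)).aemeasurable.ennreal_ofReal)
  refine le_trans (le_of_eq ?_) (hfatou.trans ?_)
  · refine lintegral_congr fun z => (Tendsto.liminf_eq ?_).symm
    refine tendsto_const_nhds.congr' ?_
    obtain ⟨R₀, hR₀⟩ := exists_nat_gt (max ‖z‖ (κ u₀ z))
    filter_upwards [eventually_ge_atTop R₀] with R hRR
    have h4 : max ‖z‖ (κ u₀ z) < R := hR₀.trans_le (by exact_mod_cast hRR)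
    have h5 : z ∈ B R := by simpa [hB] using (le_max_left _ _).trans_lt h4
    simp only [hT, Set.indicator_of_mem h5]
    rw [min_eq_left ((le_max_right _ _).trans h4.le)]
  · exact liminf_le_of_le (by isBoundedDefault) fun c hc => by
      obtain ⟨R, h6⟩ := hc.exists
      exact h6.trans (hR R)

theorem WeakStarTendsto.comp {N : ℕ}
    {a : ℕ → EuclideanSpace ℝ (Fin N) × EuclideanSpace ℝ (Fin N) → ℝ}
    {a₀ : EuclideanSpace ℝ (Fin N) × EuclideanSpace ℝ (Fin N) → ℝ} (h : WeakStarTendsto a a₀)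
    {φ : ℕ → ℕ} (hφ : Tendsto φ atTop atTop) : WeakStarTendsto (fun j => a (φ j)) a₀ :=
  fun g hg => (h g hg).comp hφ

section

variable {N : ℕ} {s p : ℝ} [hp : Fact (1 ≤ p)] {Ω : Set (EuclideanSpace ℝ (Fin N))} {α β : ℝ}
  {a : ℕ → EuclideanSpace ℝ (Fin N) × EuclideanSpace ℝ (Fin N) → ℝ}
  {a₀ : EuclideanSpace ℝ (Fin N) × EuclideanSpace ℝ (Fin N) → ℝ}

/-- With `u` fixed, the energy is the pairing of the kernel with one `L^1` function. -/
theorem tendsto_rootEnergy (hα : 0 < α) (ha : ∀ n, a n ∈ kernelClass N α β)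
    (ha₀ : a₀ ∈ kernelClass N α β) (hconv : WeakStarTendsto a a₀) (u : W0 N s p Ω) :
    Tendsto (fun n => W0.rootEnergy (a n) u) atTop (𝓝 (W0.rootEnergy a₀ u)) := by
  have hi := integrable_of_gagliardo_ne_top s p hp.out (Lp.aestronglyMeasurable (W0.toLp u))
    (W0.gagliardo_ne_top u)
  have h1 : ∀ c ∈ kernelClass N α β, energy s p c (W0.toLp u) = ENNReal.ofReal (∫ z, c z *
      (|W0.toLp u z.1 - W0.toLp u z.2| ^ p / ‖z.1 - z.2‖ ^ ((N : ℝ) + s * p))) := by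
    intro c hc
    refine (ofReal_integral_eq_lintegral_ofReal ?_ ?_).symm
    · refine hi.bdd_mul (c := β) hc.1.1 (hc.2.mono fun z hz => ?_)
      rw [Real.norm_of_nonneg (hα.le.trans hz.2.1)]
      exact hz.2.2
    · exact (kernelClass.nonneg hα hc).mono fun z hz => mul_nonneg hz (by positivity)
  refine ((ENNReal.continuous_rpow_const (y := 1 / p)).tendsto _).comp ?_
  rw [h1 a₀ ha₀]
  simp only [h1 _ (ha _)]
  exact ENNReal.tendsto_ofReal (hconv _ hi)

/-- Sublevels of the energies of `a n` are eventually close, in `L^p`, to the sublevel of the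
energy of the limit kernel. -/
theorem eventually_sublevel_near (hs : 0 < s) (hΩ : MeasurableSet Ω) (hΩfin : volume Ω < ∞)
    (hα : 0 < α) (ha : ∀ n, a n ∈ kernelClass N α β) (ha₀ : a₀ ∈ kernelClass N α β)
    (hconv : WeakStarTendsto a a₀) {M : ℝ≥0∞} (hM : M ≠ ∞) {r : ℝ} (hr : 0 < r) :
    ∀ᶠ n in atTop, ∀ u : W0 N s p Ω, ‖W0.toLp u‖ = 1 → W0.rootEnergy (a n) u ≤ M →
      ∃ w : W0 N s p Ω, ‖W0.toLp w‖ = 1 ∧ W0.rootEnergy a₀ w ≤ M ∧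
        ‖W0.toLp u - W0.toLp w‖ < r := by
  have hp1 : 1 ≤ p := hp.out
  have hp0 : 0 < p := by linarith
  -- Otherwise functions in the sublevels stay `r`-far from the limit sublevel along a subsequence.
  -- They have an `L^p` cluster point `y`, which itself lies in the limit sublevel.
  by_contra hcon
  obtain ⟨φ, hφ, hφ'⟩ := extraction_of_frequently_atTop (not_eventually.1 hcon)
  push Not at hφ'
  choose u hu1 huM hufar using hφ'
  set M' : ℝ := (M / ENNReal.ofReal α ^ (1 / p)).toReal with hM'
  have hTB := totallyBounded_image_toLp (N := N) (s := s) (p := p) hs hΩ hΩfin M'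
  have hcpt := hTB.closure.isCompact_of_isClosed isClosed_closure
  have humem : ∀ j, W0.toLp (u j) ∈ closure (W0.toLp ''
      {u : W0 N s p Ω | ‖W0.toLp u‖ ≤ 1 ∧ W0.semi u ≤ M'}) := fun j =>
    subset_closure ⟨u j, ⟨(hu1 j).le, W0.semi_le_of_rootEnergy_le hα (ha _) hM (huM j)⟩, rfl⟩
  obtain ⟨y, -, ψ, hψ, hy⟩ := hcpt.tendsto_subseq humem
  obtain ⟨θ, hθ, hae⟩ := (tendstoInMeasure_of_tendsto_Lp hy).exists_seq_tendsto_ae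
  have hsub : Tendsto (fun j => φ (ψ (θ j))) atTop atTop :=
    hφ.tendsto_atTop.comp (hψ.tendsto_atTop.comp hθ.tendsto_atTop)
  have hyE : energy s p a₀ y ≤ M ^ p := by
    refine energy_le_of_tendsto_ae s hp1 hα (fun j => ha (φ (ψ (θ j)))) ha₀ (hconv.comp hsub)
      (fun j => Lp.aestronglyMeasurable (W0.toLp (u (ψ (θ j))))) (Lp.aestronglyMeasurable y)
      hae fun j => ?_
    have h1 := ENNReal.rpow_le_rpow (huM (ψ (θ j))) hp0.le
    rwa [W0.rootEnergy, one_div, ENNReal.rpow_inv_rpow hp0.ne'] at h1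
  have hyE' : energy s p a₀ y ^ (1 / p) ≤ M := by
    have h1 := ENNReal.rpow_le_rpow hyE (z := 1 / p) (by positivity)
    rwa [one_div, ENNReal.rpow_rpow_inv hp0.ne', ← one_div] at h1
  -- A priori `y` is only in `L^p`; the lower bound `α` of the kernel puts it in `W_0^{s,p}(Ω)`.
  have hyg : gagliardo s p y < ∞ := by
    have h2 := (ofReal_mul_gagliardo_le s p hp1 hα ha₀ y).trans hyE'
    by_contra h3
    rw [not_lt, top_le_iff] at h3
    rw [h3, ENNReal.mul_top (ENNReal.rpow_pos (by simpa using hα) ENNReal.ofReal_ne_top).ne',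
      top_le_iff] at h2
    exact hM h2
  have hyΩ : ∀ᵐ x : EuclideanSpace ℝ (Fin N), x ∉ Ω → y x = 0 := by
    have h4 : ∀ᵐ x, ∀ j, x ∉ Ω → W0.toLp (u j) x = 0 := ae_all_iff.2 fun j => (u j).2.2
    filter_upwards [hae, h4] with x hx hx' hxΩ
    refine tendsto_nhds_unique hx (tendsto_const_nhds.congr fun j => ?_)
    exact (hx' _ hxΩ).symm
  have hyn : ‖y‖ = 1 := tendsto_nhds_unique hy.norm (by simp [hu1])
  have hdist : Tendsto (fun j => ‖W0.toLp (u (ψ j)) - y‖) atTop (𝓝 0) := by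
    simpa using (hy.sub_const y).norm
  obtain ⟨j, hj⟩ := (hdist.eventually (gt_mem_nhds hr)).exists
  let w : W0 N s p Ω := ⟨y, hyg, hyΩ⟩
  exact absurd hj (not_lt.2 (hufar (ψ j) w hyn hyE'))

end

/-! ### The two bounds for the limit. -/

theorem exists_div_ofReal_one_sub_lt {M b : ℝ≥0∞} (h : M < b) :
    ∃ r : ℝ, 0 < r ∧ r < 1 ∧ M / ENNReal.ofReal (1 - r) < b := by
  have h1 : Tendsto (fun r : ℝ => M / ENNReal.ofReal (1 - r)) (𝓝[>] 0) (𝓝 M) := by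
    have h2 : Tendsto (fun r : ℝ => ENNReal.ofReal (1 - r)) (𝓝[>] 0) (𝓝 1) := by
      have : Continuous fun r : ℝ => ENNReal.ofReal (1 - r) :=
        ENNReal.continuous_ofReal.comp (by fun_prop)
      simpa using (this.tendsto 0).mono_left nhdsWithin_le_nhds
    simpa using ENNReal.Tendsto.div tendsto_const_nhds (Or.inr one_ne_zero) h2
      (Or.inr h.ne_top)
  obtain ⟨r, h3, h4, h5⟩ := ((h1.eventually (gt_mem_nhds h)).and
    (Ioo_mem_nhdsGT (zero_lt_one' ℝ))).exists
  exact ⟨r, h4, h5, h3⟩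

end FracHomog

theorem mainTheorem5 (N : ℕ) (hN : 1 ≤ N) (s : ℝ) (hs0 : 0 < s) (hs1 : s < 1)
    (p : ℝ) [Fact (1 ≤ p)]
    (Ω : Set (EuclideanSpace ℝ (Fin N))) (hΩ : IsOpen Ω) (hΩfin : volume Ω < ∞)
    (α β : ℝ) (hα : 0 < α) (hαβ : α ≤ β)
    (a : ℕ → EuclideanSpace ℝ (Fin N) × EuclideanSpace ℝ (Fin N) → ℝ)
    (a₀ : EuclideanSpace ℝ (Fin N) × EuclideanSpace ℝ (Fin N) → ℝ)
    (ha : ∀ n, a n ∈ FracHomog.kernelClass N α β) (ha₀ : a₀ ∈ FracHomog.kernelClass N α β)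
    (hconv : FracHomog.WeakStarTendsto a a₀) (k : ℕ) (hk : 1 ≤ k) :
    Tendsto (fun n => FracHomog.eigenvalue s p Ω (a n) k) atTop
      (𝓝 (FracHomog.eigenvalue s p Ω a₀ k)) := by
  open FracHomog in
  refine tendsto_order.2 ⟨fun b hb => ?_, fun b hb => ?_⟩
  -- Lower bound. `M` is finite even if the limit eigenvalue is `∞`, so that case needs no separate
  -- treatment. The radius `r` is split in halves: from `G` to the limit sublevel, and from there to
  -- its net.
  · obtain ⟨M, hbM, hM⟩ := exists_between hb
    obtain ⟨r, hr0, hr1, hr⟩ := exists_div_ofReal_one_sub_lt hM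
    obtain ⟨F, hFS, hF⟩ := exists_finite_net (N := N) (s := s) (p := p) hs0 hΩ.measurableSet
      hΩfin (S := {w : W0 N s p Ω | ‖W0.toLp w‖ = 1 ∧ W0.rootEnergy a₀ w ≤ M})
      (fun w hw => hw.1) (fun w hw => W0.semi_le_of_rootEnergy_le hα ha₀ hM.ne_top hw.2)
      (half_pos hr0)
    filter_upwards [eventually_sublevel_near (Ω := Ω) (p := p) hs0 hΩ.measurableSet hΩfin hα ha ha₀ hconv
      hM.ne_top (half_pos hr0)] with n hn
    by_contra! hnb
    have h1 := hnb.trans_lt hbM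
    rw [eigenvalue_eq] at h1
    simp only [iInf_lt_iff] at h1
    obtain ⟨G, hG, hGM⟩ := h1
    refine absurd hr (not_lt.2 (eigenvalue_le_of_net hα ha₀ hG (fun w : F => w.1) hr1 ?_
      fun w => (hFS w.1 w.2).2))
    intro u hu
    obtain ⟨w, hw1, hwM, huw⟩ := hn u (hG.2.2.2.1 u hu)
      ((le_iSup₂ (f := fun v (_ : v ∈ G) => W0.rootEnergy (a n) v) u hu).trans hGM.le)
    obtain ⟨f, hf, hwf⟩ := hF w ⟨hw1, hwM⟩
    refine ⟨⟨f, hf⟩, ?_⟩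
    have := norm_sub_le_norm_sub_add_norm_sub (W0.toLp u) (W0.toLp w) (W0.toLp f)
    dsimp only
    linarith
  -- Upper bound: one set `G`, nearly optimal for `a₀`, serves for all large `n`.
  · rw [eigenvalue_eq] at hb
    simp only [iInf_lt_iff] at hb
    obtain ⟨G, hG, hGb⟩ := hb
    obtain ⟨M, hGM, hM⟩ := exists_between hGb
    have hGle : ∀ u ∈ G, W0.rootEnergy a₀ u < M := fun u hu =>
      (le_iSup₂ (f := fun v (_ : v ∈ G) => W0.rootEnergy a₀ v) u hu).trans_lt hGM
    obtain ⟨r, hr0, hr1, hr⟩ := exists_div_ofReal_one_sub_lt hM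
    obtain ⟨F, hFG, hF⟩ := exists_finite_net (N := N) (s := s) (p := p) hs0 hΩ.measurableSet
      hΩfin (S := G) hG.2.2.2.1
      (fun w hw => W0.semi_le_of_rootEnergy_le hα ha₀ hM.ne_top (hGle w hw).le) hr0
    have h2 : ∀ᶠ n in atTop, ∀ w ∈ F, W0.rootEnergy (a n) w < M :=
      (Finset.eventually_all F).2 fun w hw =>
        (tendsto_rootEnergy hα ha ha₀ hconv w).eventually (gt_mem_nhds (hGle w (hFG w hw)))
    filter_upwards [h2] with n hn
    refine (eigenvalue_le_of_net hα (ha n) hG (fun w : F => w.1) hr1 ?_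
      fun w => (hn w.1 w.2).le).trans_lt hr
    intro u hu
    obtain ⟨f, hf, huf⟩ := hF u hu
    exact ⟨⟨f, hf⟩, huf⟩
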